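/- For $0\le r<\infty$ let $\varphi(z)=z e^{1-z}$, let $\Gamma_r=\{z\in\mathbb{C}: |z e^{1-z}|=e^{-r},\ |z|\le 1\}$, and let $G_r=\operatorname{Int}(\Gamma_r)$ be the set of points of $\mathbb{C}\setminus\Gamma_r$ that lie in a bounded component of $\mathbb{C}\setminus\Gamma_r$. Then $\Gamma_r$ is a rectifiable simple closed curve, $0\in G_r$, and $\partial G_r=\Gamma_r$. Give $\Gamma_r$ the counterclockwise orientation and let $$d\mu_r(z)=\frac{1}{2\pi i}\,\frac{1-z}{z}\,dz,\qquad z\in\Gamma_r ,$$ which is a priori a complex measure. Then: 1. $\mu_r$ is a positive measure on $\Gamma_r$ of total mass $1$, and it does not depend on the (absolutely continuous, counterclockwise, simple) parametrization of $\Gamma_r$ through which $dz$ is understood. 2. $\mu_r$ is the balayage of the Dirac measure $\delta_0$ from $G_r$ onto $\Gamma_r$. Here a positive measure $\widehat\sigma$ is called the balayage of a finite positive measure $\sigma$ with compact support in $\Omega$, from an open set $\Omega$ with compact boundary onto $\partial\Omega$, if $\widehat\sigma$ is carried by $\partial\Omega$, has the same total mass as $\sigma$, and for some constant $c$, with $c=0$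 if $\Omega$ is bounded, $V^{\widehat\sigma}(z)-V^{\sigma}(z)=c$ for all $z\notin\Omega$ outside a set of logarithmic capacity zero, where $V^\sigma(z)=-\int\log|z-t|\,d\sigma(t)$. 3. $\varphi$ maps $G_r$ conformally (holomorphically and bijectively) onto the disk $\{|w|<e^{-r}\}$ and maps $\Gamma_r$ bijectively onto the circle $\{|w|=e^{-r}\}$, and $\mu_r$ is the pullback under $\varphi$ of the normalized arc length $m$ on that circle: $\mu_r(A)=m(\varphi(A))$ for every Borel set $A\subseteq\Gamma_r$. 4. $\mu_r$ is the harmonic measure of the bounded domain $G_r$ at $0$: every continuous $f:\Gamma_r\to\mathbb{R}$ extends to a continuous function $h$ on $\overline{G_r}$ that is harmonic in $G_r$ and satisfies $h(0)=\int_{\Gamma_r} f\,d\mu_r$. -/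

import Mathlib

open MeasureTheory

noncomputable section

namespace Szego

/-! ### Contours and complex line measures -/

/-- The interior of a closed curve with trace `S`: the points off `S` whose connected component in
the complement of `S` is bounded. -/
def curveInterior (S : Set ℂ) : Set ℂ :=
  {z | z ∈ Sᶜ ∧ Bornology.IsBounded (connectedComponentIn Sᶜ z)}

/-- The winding number `(1 / 2πi) ∮_γ dz / (z - a)` of a closed curve about `a`. -/
def windingNumber {x : ℂ} (γ : Path x x) (a : ℂ) : ℂ :=
  (2 * Real.pi * Complex.I)⁻¹ *
    ∫ t in (0 : ℝ)..1, deriv γ.extend t / (γ.extend t - a)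

/-- `γ` is a rectifiable simple closed curve with trace `S`, run through once counterclockwise.
The parametrization is absolutely continuous, which covers in particular every piecewise `C¹`
parametrization and every parametrization by (a multiple of) arc length. -/
structure IsPositiveContour {x : ℂ} (γ : Path x x) (S : Set ℂ) : Prop where
  absolutelyContinuous : AbsolutelyContinuousOnInterval γ.extend 0 1
  simple : Set.InjOn γ.extend (Set.Ico 0 1)
  trace : Set.range γ = S
  counterclockwise : ∀ a ∈ curveInterior S, windingNumber γ a = 1

/-- The complex Borel measure `f(z) dz` along `γ`, that is,
`A ↦ ∫_{t ∈ [0, 1], γ(t) ∈ A} f(γ(t)) γ'(t) dt`. -/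
def lineMeasure (f : ℂ → ℂ) {x : ℂ} (γ : Path x x) : ComplexMeasure ℂ :=
  ((volume.restrict (Set.Ioc (0 : ℝ) 1)).withDensityᵥ
    (fun t => f (γ.extend t) * deriv γ.extend t)).map γ.extend

/-! ### Logarithmic potential theory -/

/-- The positive part of `log (1 / |z - t|)`, equal to `∞` for `z = t`. -/
def logKernelPos (z t : ℂ) : ENNReal := (ENNReal.log (edist z t)⁻¹).toENNReal

/-- The negative part of `log (1 / |z - t|)`. -/
def logKernelNeg (z t : ℂ) : ENNReal := (ENNReal.log (edist z t)).toENNReal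

/-- The logarithmic potential `V^μ(z) = ∫ log (1 / |z - t|) dμ(t)`, with values in `(-∞, ∞]` for
finite measures `μ` with compact support. -/
def logPotential (μ : Measure ℂ) (z : ℂ) : EReal :=
  ((∫⁻ t, logKernelPos z t ∂μ : ENNReal) : EReal) - ((∫⁻ t, logKernelNeg z t ∂μ : ENNReal) : EReal)

/-- The logarithmic energy `I(μ) = ∬ log (1 / |z - t|) dμ(t) dμ(z)`, with values in `(-∞, ∞]` for
finite measures `μ` with compact support. -/
def logEnergy (μ : Measure ℂ) : EReal :=
  ((∫⁻ z, ∫⁻ t, logKernelPos z t ∂μ ∂μ : ENNReal) : EReal) -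
    ((∫⁻ z, ∫⁻ t, logKernelNeg z t ∂μ ∂μ : ENNReal) : EReal)

/-- The logarithmic capacity of `E`: the supremum of `exp (-I(μ))` over the probability measures `μ`
carried by a compact subset of `E`. -/
def logCapacity (E : Set ℂ) : ENNReal :=
  ⨆ μ ∈ {μ : Measure ℂ | IsProbabilityMeasure μ ∧ ∃ K ⊆ E, IsCompact K ∧ μ Kᶜ = 0},
    EReal.exp (-logEnergy μ)

/-- `P` holds at quasi-every point of `S`: the exceptional points lie in a Borel set of
logarithmic capacity zero. -/
def QuasiEverywhereOn (S : Set ℂ) (P : ℂ → Prop) : Prop :=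
  ∃ N : Set ℂ, MeasurableSet N ∧ logCapacity N = 0 ∧ ∀ z ∈ S \ N, P z

/-- `τ` is a balayage of `σ` from the open set `Ω` onto `∂Ω`. -/
structure IsBalayage (Ω : Set ℂ) (σ τ : Measure ℂ) : Prop where
  isOpen : IsOpen Ω
  isCompact_frontier : IsCompact (frontier Ω)
  finite : IsFiniteMeasure σ
  compactSupport : ∃ K ⊆ Ω, IsCompact K ∧ σ Kᶜ = 0
  carrier : τ (frontier Ω)ᶜ = 0
  mass_eq : τ Set.univ = σ Set.univ
  potential_eq : ∃ c : ℝ, (Bornology.IsBounded Ω → c = 0) ∧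
    QuasiEverywhereOn Ωᶜ (fun z => logPotential τ z - logPotential σ z = (c : EReal))

/-- `ω` is the harmonic measure at `a ∈ Ω` of a bounded domain `Ω` that is regular for the Dirichlet
problem: a probability measure carried by `∂Ω` such that each continuous boundary function `f` has a
continuous extension `h` to the closure of `Ω`, harmonic in `Ω`, with `h(a) = ∫ f dω`. -/
structure IsHarmonicMeasure (Ω : Set ℂ) (a : ℂ) (ω : Measure ℂ) : Prop where
  isOpen : IsOpen Ω
  isConnected : IsConnected Ω
  isBounded : Bornology.IsBounded Ω
  mem : a ∈ Ω
  isProbabilityMeasure : IsProbabilityMeasure ω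
  carrier : ω (frontier Ω)ᶜ = 0
  dirichlet : ∀ f : ℂ → ℝ, ContinuousOn f (frontier Ω) →
    ∃ h : ℂ → ℝ, ContinuousOn h (closure Ω) ∧ InnerProductSpace.HarmonicOnNhd h Ω ∧
      Set.EqOn h f (frontier Ω) ∧ h a = ∫ z, f z ∂ω

/-- Normalized arc length on the circle of radius `R` about `0`. -/
def circleArcLength (R : ℝ) : Measure ℂ :=
  (ENNReal.ofReal (2 * Real.pi))⁻¹ •
    (volume.restrict (Set.Ioc 0 (2 * Real.pi))).map (circleMap 0 R)

/-! ### The level curves of the Szegő curve -/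

/-- The function `φ(z) = z e^{1 - z}`. -/
def phi (z : ℂ) : ℂ := z * Complex.exp (1 - z)

/-- The level curve `Γ_r = {|z e^{1 - z}| = e^{-r}, |z| ≤ 1}`. -/
def levelCurve (r : ℝ) : Set ℂ := {z | ‖phi z‖ = Real.exp (-r) ∧ ‖z‖ ≤ 1}

/-- The interior `G_r` of `Γ_r`. -/
def levelInterior (r : ℝ) : Set ℂ := curveInterior (levelCurve r)

/-- The density `(1 / 2πi) (1 - z) / z` with respect to `dz`. -/
def szegoDensity (z : ℂ) : ℂ := (2 * Real.pi * Complex.I)⁻¹ * ((1 - z) / z)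

end Szego

end

open Szego

namespace Szego

open Complex Metric Set

/-! ### The function `φ` on the closed unit disk -/

/-! The logarithmic derivative of `phi` is `(1 - z) / z`, so the measure is `dφ / (2πi φ)`. On the
level curve `log |φ|` is constant, which leaves `dθ / 2π` with `θ = arg φ`: everything is the
unit-circle picture carried back by `phi`.

The carrying is possible because `phi` is injective on the closed unit disk (`injOn_phi`) and its
image covers that disk (`closedBall_subset_image_phi`). Its inverse `W = phiInv` is continuous on
the closed disk and holomorphic at each of its points except `w = 1`, the image of the critical
point `z = 1`, where `1 - W` is bounded below by a multiple of `|1 - w|^{1/2}`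
(`norm_one_sub_le_phiInv`). That bound makes `W'` integrable on the circle even for `r = 0`, so the
level curve is rectifiable.

For an arbitrary positive contour, simplicity and winding number `1` about `0` make `arg φ` increase
strictly by `2π`; substitution then gives the same measure `levelMeasure` for all contours
(`lineMeasure_szegoDensity`). Harmonic measure is the Poisson integral composed with `phi`, since
`phi 0 = 0`. For the balayage, `log |z - W(w)|` is harmonic in the disk when `z` is off `G_r`, so
its circle mean is its central value `log |z|` (`circleAverage_log_norm_sub_phiInv`). -/

lemma norm_phi (z : ℂ) : ‖phi z‖ = ‖z‖ * Real.exp (1 - z.re) := by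
  simp [phi, Complex.norm_exp]

@[simp] lemma phi_zero : phi 0 = 0 := by simp [phi]

@[simp] lemma phi_one : phi 1 = 1 := by simp [phi]

lemma hasStrictDerivAt_phi (z : ℂ) : HasStrictDerivAt phi (exp (1 - z) * (1 - z)) z := by
  have h : HasStrictDerivAt (fun z : ℂ => exp (1 - z)) (exp (1 - z) * -1) z :=
    ((hasStrictDerivAt_id z).const_sub 1).cexp
  refine ((hasStrictDerivAt_id z).mul h).congr_deriv ?_
  simp only [id]
  ring

lemma hasDerivAt_phi (z : ℂ) : HasDerivAt phi (exp (1 - z) * (1 - z)) z :=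
  (hasStrictDerivAt_phi z).hasDerivAt

lemma differentiable_phi : Differentiable ℂ phi := fun z => (hasDerivAt_phi z).differentiableAt

lemma continuous_phi : Continuous phi := differentiable_phi.continuous

/-- In the closed right half plane `|1 - e^{-u}| < |u|`, except at `u = 0`. -/
lemma norm_one_sub_exp_neg_lt {u : ℂ} (hu : u ≠ 0) (hre : 0 ≤ u.re) : ‖1 - exp (-u)‖ < ‖u‖ := by
  refine lt_of_pow_lt_pow_left₀ 2 (norm_nonneg _) ?_
  have h1 : ‖1 - exp (-u)‖ ^ 2 =
      (1 - Real.exp (-u.re)) ^ 2 + 2 * Real.exp (-u.re) * (1 - Real.cos u.im) := by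
    rw [Complex.sq_norm, Complex.normSq_apply]
    simp only [sub_re, one_re, sub_im, one_im, exp_re, exp_im, neg_re, neg_im, Real.cos_neg,
      Real.sin_neg]
    linear_combination (Real.exp (-u.re)) ^ 2 * Real.sin_sq_add_cos_sq u.im
  have h2 : ‖u‖ ^ 2 = u.re ^ 2 + u.im ^ 2 := by
    rw [Complex.sq_norm, Complex.normSq_apply]; ring
  rw [h1, h2]
  have he : Real.exp (-u.re) ≤ 1 := Real.exp_le_one_iff.2 (by linarith)
  have hp := Real.exp_pos (-u.re)
  have hc : 0 ≤ 1 - Real.cos u.im := by linarith [Real.cos_le_one u.im]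
  have hc' : 1 - Real.cos u.im ≤ u.im ^ 2 / 2 := by
    linarith [Real.one_sub_sq_div_two_le_cos (x := u.im)]
  have hB : Real.exp (-u.re) * (1 - Real.cos u.im) ≤ 1 - Real.cos u.im :=
    mul_le_of_le_one_left hc he
  rcases hre.eq_or_lt with h0 | h0
  -- On the imaginary axis the exponential gives no gain; strictness comes from the cosine bound.
  · have him : u.im ≠ 0 := fun h => hu (Complex.ext h0.symm h)
    have := Real.one_sub_sq_div_two_lt_cos him
    rw [← h0] at hB ⊢
    norm_num at hB ⊢
    linarith
  · have h3 : 1 - Real.exp (-u.re) < u.re := by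
      linarith [Real.add_one_lt_exp (x := -u.re) (by linarith)]
    have h4 : (1 - Real.exp (-u.re)) ^ 2 < u.re ^ 2 := by
      apply pow_lt_pow_left₀ h3 (by linarith) (by norm_num)
    linarith

/-- With `u = z - w`, equality of values reads `u = z (1 - e^{-u})`, so `|u| ≤ |1 - e^{-u}|`.
Exchanging `z` and `w` secures `Re u ≥ 0`, where this forces `u = 0`. -/
lemma injOn_phi : InjOn phi (closedBall 0 1) := by
  have key : ∀ z w : ℂ, ‖z‖ ≤ 1 → phi z = phi w → 0 ≤ (z - w).re → z = w := by
    intro z w hz h hre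
    by_contra hne
    have hu : z - w ≠ 0 := sub_ne_zero.2 hne
    have h1 : w = z * exp (-(z - w)) := by
      have : w * exp (1 - w) * exp (w - 1) = z * exp (1 - z) * exp (w - 1) := by
        simp only [phi] at h; rw [h]
      rw [mul_assoc, ← Complex.exp_add, mul_assoc, ← Complex.exp_add] at this
      ring_nf at this
      rw [Complex.exp_zero, mul_one] at this
      convert this using 3
      ring
    have h2 : z - w = z * (1 - exp (-(z - w))) := by
      rw [mul_sub, mul_one, ← h1]
    have h3 := norm_one_sub_exp_neg_lt hu hre
    have h4 : ‖z - w‖ ≤ ‖1 - exp (-(z - w))‖ := by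
      conv_lhs => rw [h2, norm_mul]
      exact mul_le_of_le_one_left (norm_nonneg _) hz
    linarith
  intro z hz w hw h
  rw [mem_closedBall_zero_iff] at hz hw
  rcases le_total 0 (z - w).re with h0 | h0
  · exact key z w hz h h0
  · refine (key w z hw h.symm ?_).symm
    simp only [sub_re] at h0 ⊢
    linarith

lemma re_le_one_of_norm_le_one {z : ℂ} (hz : ‖z‖ ≤ 1) : z.re ≤ 1 := (re_le_norm z).trans hz

/-- On the unit circle `|φ| = e^{1 - Re z} ≥ 1`. -/
lemma norm_lt_one_of_norm_phi_lt_one {z : ℂ} (hz : ‖z‖ ≤ 1) (h : ‖phi z‖ < 1) : ‖z‖ < 1 := by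
  refine hz.lt_of_ne fun h1 => ?_
  rw [norm_phi, h1, one_mul] at h
  have := Real.one_le_exp (x := 1 - z.re) (by linarith [re_le_one_of_norm_le_one hz])
  linarith

lemma norm_lt_one_of_ne_one {z : ℂ} (hz : ‖z‖ ≤ 1) (h : ‖phi z‖ ≤ 1) (hne : z ≠ 1) : ‖z‖ < 1 := by
  refine hz.lt_of_ne fun h1 => hne ?_
  rw [norm_phi, h1, one_mul, Real.exp_le_one_iff] at h
  have hre : z.re = 1 := le_antisymm (re_le_one_of_norm_le_one hz) (by linarith)
  have h2 : ‖z‖ ^ 2 = z.re ^ 2 + z.im ^ 2 := by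
    rw [Complex.sq_norm, Complex.normSq_apply]; ring
  rw [h1, hre] at h2
  exact Complex.ext hre (by simpa using (by nlinarith : z.im = 0))

/-- The image of the open disk is open, and relatively closed in the open unit disk because boundary
points have `|φ| ≥ 1`. Connectedness gives the open disk, compactness the closed one. -/
lemma closedBall_subset_image_phi : closedBall (0 : ℂ) 1 ⊆ phi '' closedBall 0 1 := by
  have hcl : IsClosed (phi '' closedBall 0 1) :=
    ((isCompact_closedBall 0 1).image continuous_phi).isClosed
  have hopen : IsOpen (phi '' ball 0 1) := by
    rcases AnalyticOnNhd.is_constant_or_isOpen (g := phi) (U := univ)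
      (fun z _ => differentiable_phi.analyticAt z) isPreconnected_univ with ⟨w, h⟩ | h
    · have := (h 0 trivial).trans (h 1 trivial).symm
      simp at this
    · exact h _ (subset_univ _) isOpen_ball
  have hball : ball (0 : ℂ) 1 ⊆ phi '' ball 0 1 := by
    refine (convex_ball (0 : ℂ) 1).isPreconnected.subset_of_closure_inter_subset hopen
      ⟨0, by simp, 0, by simp, by simp⟩ ?_
    rintro w ⟨hw, hw1⟩
    obtain ⟨z, hz, rfl⟩ := closure_minimal (image_mono ball_subset_closedBall) hcl hw
    rw [mem_closedBall_zero_iff] at hz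
    rw [mem_ball_zero_iff] at hw1
    exact ⟨z, mem_ball_zero_iff.2 (norm_lt_one_of_norm_phi_lt_one hz hw1), rfl⟩
  rw [← closure_ball (0 : ℂ) one_ne_zero]
  exact closure_minimal (hball.trans (image_mono (by
    rw [closure_ball (0 : ℂ) one_ne_zero]; exact ball_subset_closedBall)))
    (by rwa [closure_ball (0 : ℂ) one_ne_zero])

/-- The point `1` is a critical point of `φ`: `|1 - φ(z)| ≤ 3 |1 - z|²` where `|φ| ≤ 1`. -/
lemma norm_one_sub_phi_le {z : ℂ} (h : ‖phi z‖ ≤ 1) : ‖1 - phi z‖ ≤ 3 * ‖1 - z‖ ^ 2 := by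
  rcases le_total ‖1 - z‖ 1 with h1 | h1
  · have hE := Complex.norm_exp_sub_one_sub_id_le h1
    set u := 1 - z with hu
    have hz : z = 1 - u := by rw [hu]; ring
    -- Here `φ = (1 - u) e^u = 1 - u² + (1 - u)(e^u - 1 - u)`; the constant is `3 = 1 + 2`, with `2`
    -- bounding `|1 - u|`.
    have hphi : 1 - phi z = u ^ 2 - (1 - u) * (exp u - 1 - u) := by
      rw [phi, ← hu, hz]; ring
    have h2 : ‖1 - u‖ ≤ 2 := (norm_sub_le _ _).trans (by rw [norm_one]; linarith)
    calc ‖1 - phi z‖ ≤ ‖u ^ 2‖ + ‖(1 - u) * (exp u - 1 - u)‖ := by rw [hphi]; exact norm_sub_le _ _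
      _ ≤ ‖u‖ ^ 2 + 2 * ‖u‖ ^ 2 := by
          rw [norm_pow, norm_mul]; gcongr
      _ = 3 * ‖u‖ ^ 2 := by ring
  · calc ‖1 - phi z‖ ≤ ‖(1 : ℂ)‖ + ‖phi z‖ := norm_sub_le _ _
      _ ≤ 3 * ‖1 - z‖ ^ 2 := by rw [norm_one]; nlinarith

/-- The constant bounds `|φ'| = |e^{1-z} (1 - z)|` on the disk. Read backwards, this bounds
increments of the inverse from below. -/
lemma norm_phi_sub_phi_le {z w : ℂ} (hz : ‖z‖ ≤ 1) (hw : ‖w‖ ≤ 1) :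
    ‖phi z - phi w‖ ≤ Real.exp 2 * 2 * ‖z - w‖ := by
  refine (convex_closedBall (0 : ℂ) 1).norm_image_sub_le_of_norm_hasDerivWithin_le
    (f' := fun z => exp (1 - z) * (1 - z))
    (fun x _ => (hasDerivAt_phi x).hasDerivWithinAt) (fun x hx => ?_)
    (mem_closedBall_zero_iff.2 hw) (mem_closedBall_zero_iff.2 hz)
  rw [mem_closedBall_zero_iff] at hx
  rw [norm_mul, Complex.norm_exp]
  have h1 : -x.re ≤ 1 := (neg_le_abs x.re).trans ((abs_re_le_norm x).trans hx)
  have h2 : ‖1 - x‖ ≤ 2 := (norm_sub_le _ _).trans (by rw [norm_one]; linarith)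
  gcongr
  simp only [sub_re, one_re]
  linarith

/-! ### The inverse function -/

/-- The inverse of `φ` on the closed unit disk. -/
noncomputable def phiInv : ℂ → ℂ := Function.invFunOn phi (closedBall 0 1)

lemma norm_phiInv_le {w : ℂ} (hw : ‖w‖ ≤ 1) : ‖phiInv w‖ ≤ 1 :=
  mem_closedBall_zero_iff.1
    (Function.invFunOn_mem (closedBall_subset_image_phi (mem_closedBall_zero_iff.2 hw)))

lemma phi_phiInv {w : ℂ} (hw : ‖w‖ ≤ 1) : phi (phiInv w) = w :=
  Function.invFunOn_eq (closedBall_subset_image_phi (mem_closedBall_zero_iff.2 hw))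

lemma phiInv_phi {z : ℂ} (hz : ‖z‖ ≤ 1) : phiInv (phi z) = z :=
  injOn_phi.leftInvOn_invFunOn (mem_closedBall_zero_iff.2 hz)

@[simp] lemma phiInv_zero : phiInv 0 = 0 := by
  simpa using phiInv_phi (z := 0) (by simp)

lemma phiInv_injOn : InjOn phiInv (closedBall 0 1) := fun a ha b hb h => by
  rw [← phi_phiInv (mem_closedBall_zero_iff.1 ha), h, phi_phiInv (mem_closedBall_zero_iff.1 hb)]

/-- Preimages of closed sets are images under `phi` of compact sets. -/
lemma continuousOn_phiInv : ContinuousOn phiInv (closedBall 0 1) := by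
  rw [continuousOn_iff_isClosed]
  intro t ht
  refine ⟨phi '' (closedBall 0 1 ∩ t),
    (((isCompact_closedBall 0 1).inter_right ht).image continuous_phi).isClosed, ?_⟩
  ext w
  refine and_congr_left fun hw => ?_
  rw [mem_closedBall_zero_iff] at hw
  constructor
  · exact fun h => ⟨_, ⟨mem_closedBall_zero_iff.2 (norm_phiInv_le hw), h⟩, phi_phiInv hw⟩
  · rintro ⟨z, ⟨hz, hzt⟩, rfl⟩
    rwa [mem_preimage, phiInv_phi (mem_closedBall_zero_iff.1 hz)]

lemma norm_phiInv_lt_one {w : ℂ} (hw : ‖w‖ ≤ 1) (h1 : w ≠ 1) : ‖phiInv w‖ < 1 :=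
  norm_lt_one_of_ne_one (norm_phiInv_le hw) (by rwa [phi_phiInv hw])
    fun h => h1 (by rw [← phi_phiInv hw, h, phi_one])

lemma phiInv_ne_one {w : ℂ} (hw : ‖w‖ ≤ 1) (h1 : w ≠ 1) : phiInv w ≠ 1 :=
  fun h => by simpa [h] using norm_phiInv_lt_one hw h1

/-- Even for `|w| = 1` the preimage lies in the open disk, where `phiInv` is a left inverse of
`phi`; so it agrees with the local inverse on a full neighbourhood of `w`. -/
lemma hasDerivAt_phiInv {w : ℂ} (hw : ‖w‖ ≤ 1) (h1 : w ≠ 1) :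
    HasDerivAt phiInv (exp (1 - phiInv w) * (1 - phiInv w))⁻¹ w := by
  have hlt := norm_phiInv_lt_one hw h1
  have hne : exp (1 - phiInv w) * (1 - phiInv w) ≠ 0 :=
    mul_ne_zero (Complex.exp_ne_zero _) (sub_ne_zero.2 (phiInv_ne_one hw h1).symm)
  have h := (hasStrictDerivAt_phi (phiInv w)).to_local_left_inverse (g := phiInv) hne
  rw [phi_phiInv hw] at h
  refine (h ?_).hasDerivAt
  filter_upwards [isOpen_ball.mem_nhds (mem_ball_zero_iff.2 hlt)] with x hx
  exact phiInv_phi (mem_ball_zero_iff.1 hx).le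

/-- The derivative of `W = phiInv`, multiplied by `w`, equals `W / (1 - W)`. -/
lemma mul_inv_deriv_phi_phiInv {w : ℂ} (hw : ‖w‖ ≤ 1) :
    w * (exp (1 - phiInv w) * (1 - phiInv w))⁻¹ = phiInv w / (1 - phiInv w) := by
  have h : w = phiInv w * exp (1 - phiInv w) := (phi_phiInv hw).symm
  calc w * (exp (1 - phiInv w) * (1 - phiInv w))⁻¹
      = phiInv w * exp (1 - phiInv w) * (exp (1 - phiInv w) * (1 - phiInv w))⁻¹ := by rw [← h]
    _ = phiInv w / (1 - phiInv w) := by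
        rw [mul_inv, div_eq_mul_inv, mul_assoc, mul_inv_cancel_left₀ (Complex.exp_ne_zero _)]

lemma norm_one_sub_le_phiInv {w : ℂ} (hw : ‖w‖ ≤ 1) : ‖1 - w‖ ≤ 3 * ‖1 - phiInv w‖ ^ 2 := by
  simpa [phi_phiInv hw] using norm_one_sub_phi_le (z := phiInv w) (by rwa [phi_phiInv hw])

lemma norm_sub_le_phiInv {v w : ℂ} (hv : ‖v‖ ≤ 1) (hw : ‖w‖ ≤ 1) :
    ‖v - w‖ ≤ Real.exp 2 * 2 * ‖phiInv v - phiInv w‖ := by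
  simpa [phi_phiInv hv, phi_phiInv hw] using
    norm_phi_sub_phi_le (norm_phiInv_le hv) (norm_phiInv_le hw)

/-! ### The level curve and its interior -/

lemma levelCurve_subset (r : ℝ) : levelCurve r ⊆ closedBall 0 1 := fun _ hz =>
  mem_closedBall_zero_iff.2 hz.2

lemma isCompact_levelCurve (r : ℝ) : IsCompact (levelCurve r) := by
  refine (isCompact_closedBall (0 : ℂ) 1).of_isClosed_subset ?_ (levelCurve_subset r)
  exact (isClosed_eq continuous_phi.norm continuous_const).inter
    (isClosed_le continuous_norm continuous_const)

lemma zero_notMem_levelCurve (r : ℝ) : (0 : ℂ) ∉ levelCurve r := fun h => by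
  have := h.1
  rw [phi_zero, norm_zero] at this
  exact (Real.exp_pos (-r)).ne this

/-- Along rays inside the unit disk, `|φ|` is increasing. -/
lemma norm_phi_le_of_one_le {z : ℂ} {t : ℝ} (ht : 1 ≤ t) (h : ‖(t : ℂ) * z‖ ≤ 1) :
    ‖phi z‖ ≤ ‖phi (t * z)‖ := by
  have ht0 : 0 < t := by linarith
  rw [norm_phi, norm_phi, norm_mul, Complex.norm_real, Real.norm_of_nonneg ht0.le,
    mul_comm t, mul_assoc]
  refine mul_le_mul_of_nonneg_left ?_ (norm_nonneg _)
  -- After taking logarithms the goal is `(t - 1) Re z ≤ log t`, where `Re z ≤ 1/t`.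
  have hre : t * z.re ≤ 1 := by simpa using re_le_one_of_norm_le_one h
  have hlog : 1 - t⁻¹ ≤ Real.log t := Real.one_sub_inv_le_log_of_pos ht0
  have h1 : (t - 1) * z.re ≤ 1 - t⁻¹ := by
    have : z.re ≤ t⁻¹ := by rw [← one_div, le_div_iff₀ ht0]; linarith
    calc (t - 1) * z.re ≤ (t - 1) * t⁻¹ := by gcongr
      _ = 1 - t⁻¹ := by field_simp
  conv_rhs => rw [← Real.exp_log ht0]
  rw [← Real.exp_add, Real.exp_le_exp, Real.exp_log ht0]
  simp only [mul_re, ofReal_re, ofReal_im, zero_mul, sub_zero]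
  linarith

variable {r : ℝ}

lemma mem_levelRegion_iff (hr : 0 ≤ r) {z : ℂ} :
    (‖z‖ ≤ 1 ∧ ‖phi z‖ < Real.exp (-r)) ↔ (‖z‖ < 1 ∧ ‖phi z‖ < Real.exp (-r)) := by
  refine and_congr_left fun h => ⟨fun hz => norm_lt_one_of_norm_phi_lt_one hz ?_, le_of_lt⟩
  exact h.trans_le (Real.exp_le_one_iff.2 (by linarith))

/-- From a point off both the region and the curve, the outward ray never meets the curve, since
`|φ|` increases along it inside the disk; its component is unbounded. Conversely, the region is open
and its boundary lies on the curve, so a component meeting it stays inside. -/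
lemma levelInterior_eq (hr : 0 ≤ r) :
    levelInterior r = {z | ‖z‖ ≤ 1 ∧ ‖phi z‖ < Real.exp (-r)} := by
  set U : Set ℂ := {z | ‖z‖ ≤ 1 ∧ ‖phi z‖ < Real.exp (-r)} with hU
  have hUopen : IsOpen U := by
    have : U = {z | ‖z‖ < 1 ∧ ‖phi z‖ < Real.exp (-r)} := by
      ext z; exact mem_levelRegion_iff hr
    rw [this]
    exact (isOpen_lt continuous_norm continuous_const).inter
      (isOpen_lt continuous_phi.norm continuous_const)
  have hclosed : IsClosed {z : ℂ | ‖z‖ ≤ 1 ∧ ‖phi z‖ ≤ Real.exp (-r)} :=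
    (isClosed_le continuous_norm continuous_const).inter
      (isClosed_le continuous_phi.norm continuous_const)
  have hclos : closure U ⊆ {z : ℂ | ‖z‖ ≤ 1 ∧ ‖phi z‖ ≤ Real.exp (-r)} :=
    closure_minimal (fun z hz => ⟨hz.1, hz.2.le⟩) hclosed
  ext z
  constructor
  · rintro ⟨hz, hb⟩
    by_contra hzU
    have hz0 : z ≠ 0 := by
      rintro rfl
      exact hzU ⟨by simp, by simpa using Real.exp_pos _⟩
    have hray : IsPreconnected ((fun t : ℝ => (t : ℂ) * z) '' Ici 1) :=
      isPreconnected_Ici.image _ (by fun_prop)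
    have hsub : (fun t : ℝ => (t : ℂ) * z) '' Ici 1 ⊆ (levelCurve r)ᶜ := by
      rintro _ ⟨t, ht, rfl⟩ hmem
      have ht1 : (1 : ℝ) ≤ t := ht
      have h1 := norm_phi_le_of_one_le ht1 hmem.2
      rw [hmem.1] at h1
      have hzn : ‖z‖ ≤ 1 := by
        refine le_trans ?_ hmem.2
        rw [norm_mul, Complex.norm_real, Real.norm_of_nonneg (by linarith)]
        exact le_mul_of_one_le_left (norm_nonneg _) ht1
      rcases h1.lt_or_eq with h | h
      · exact hzU ⟨hzn, h⟩
      · exact hz ⟨h, hzn⟩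
    have hcc := hray.subset_connectedComponentIn (x := z) ⟨1, by simp, by simp⟩ hsub
    obtain ⟨C, hC⟩ := (hb.subset hcc).exists_norm_le
    have hzp : 0 < ‖z‖ := norm_pos_iff.2 hz0
    have h2 := hC _ ⟨max 1 ((C + 1) / ‖z‖), by simp, rfl⟩
    rw [norm_mul, Complex.norm_real, Real.norm_of_nonneg (by positivity)] at h2
    have h3 : (C + 1) / ‖z‖ * ‖z‖ ≤ max 1 ((C + 1) / ‖z‖) * ‖z‖ := by
      gcongr; exact le_max_right _ _
    rw [div_mul_cancel₀ _ hzp.ne'] at h3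
    linarith
  · intro hz
    have hzc : z ∈ (levelCurve r)ᶜ := fun h => hz.2.ne h.1
    refine ⟨hzc, ?_⟩
    have : connectedComponentIn (levelCurve r)ᶜ z ⊆ U := by
      refine isPreconnected_connectedComponentIn.subset_of_closure_inter_subset hUopen
        ⟨z, mem_connectedComponentIn hzc, hz⟩ ?_
      rintro w ⟨hw, hwc⟩
      have h1 := hclos hw
      have h2 := connectedComponentIn_subset _ _ hwc
      exact ⟨h1.1, h1.2.lt_of_ne fun h => h2 ⟨h, h1.1⟩⟩
    refine (isBounded_closedBall (x := (0 : ℂ)) (r := 1)).subset (this.trans fun w hw => ?_)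
    exact mem_closedBall_zero_iff.2 hw.1

lemma isOpen_levelInterior (hr : 0 ≤ r) : IsOpen (levelInterior r) := by
  have : levelInterior r = {z | ‖z‖ < 1 ∧ ‖phi z‖ < Real.exp (-r)} := by
    rw [levelInterior_eq hr]; ext z; exact mem_levelRegion_iff hr
  rw [this]
  exact (isOpen_lt continuous_norm continuous_const).inter
    (isOpen_lt continuous_phi.norm continuous_const)

lemma exp_neg_le_one (hr : 0 ≤ r) : Real.exp (-r) ≤ 1 := Real.exp_le_one_iff.2 (by linarith)

lemma zero_mem_levelInterior (hr : 0 ≤ r) : (0 : ℂ) ∈ levelInterior r := by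
  rw [levelInterior_eq hr]
  exact ⟨by simp, by simpa using Real.exp_pos _⟩

lemma isBounded_levelInterior (hr : 0 ≤ r) : Bornology.IsBounded (levelInterior r) := by
  rw [levelInterior_eq hr]
  exact isBounded_closedBall.subset fun z hz => mem_closedBall_zero_iff.2 hz.1

lemma image_phiInv_ball (hr : 0 ≤ r) : phiInv '' ball 0 (Real.exp (-r)) = levelInterior r := by
  rw [levelInterior_eq hr]
  ext z
  constructor
  · rintro ⟨w, hw, rfl⟩
    rw [mem_ball_zero_iff] at hw
    have hw1 : ‖w‖ ≤ 1 := hw.le.trans (exp_neg_le_one hr)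
    exact ⟨norm_phiInv_le hw1, by rwa [phi_phiInv hw1]⟩
  · rintro ⟨hz, h⟩
    exact ⟨phi z, mem_ball_zero_iff.2 h, phiInv_phi hz⟩

lemma closure_levelInterior (hr : 0 ≤ r) :
    closure (levelInterior r) = {z | ‖z‖ ≤ 1 ∧ ‖phi z‖ ≤ Real.exp (-r)} := by
  refine Subset.antisymm (closure_minimal ?_ ?_) ?_
  · rw [levelInterior_eq hr]
    exact fun z hz => ⟨hz.1, hz.2.le⟩
  · exact (isClosed_le continuous_norm continuous_const).inter
      (isClosed_le continuous_phi.norm continuous_const)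
  · rintro z ⟨hz, h⟩
    have hsub : closedBall (0 : ℂ) (Real.exp (-r)) ⊆ closedBall 0 1 :=
      closedBall_subset_closedBall (exp_neg_le_one hr)
    rw [← image_phiInv_ball hr, ← phiInv_phi hz]
    have hc : ContinuousOn phiInv (closure (ball (0 : ℂ) (Real.exp (-r)))) := by
      rw [closure_ball _ (Real.exp_pos _).ne']
      exact continuousOn_phiInv.mono hsub
    refine hc.image_closure (mem_image_of_mem _ ?_)
    rw [closure_ball _ (Real.exp_pos _).ne']
    exact mem_closedBall_zero_iff.2 h

lemma frontier_levelInterior (hr : 0 ≤ r) : frontier (levelInterior r) = levelCurve r := by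
  rw [(isOpen_levelInterior hr).frontier_eq, closure_levelInterior hr, levelInterior_eq hr]
  ext z
  constructor
  · rintro ⟨⟨h1, h2⟩, h3⟩
    exact ⟨h2.eq_of_not_lt fun h => h3 ⟨h1, h⟩, h1⟩
  · rintro ⟨h1, h2⟩
    exact ⟨⟨h2, h1.le⟩, fun h => h.2.ne h1⟩

lemma isConnected_levelInterior (hr : 0 ≤ r) : IsConnected (levelInterior r) := by
  refine ⟨⟨0, zero_mem_levelInterior hr⟩, ?_⟩
  rw [← image_phiInv_ball hr]
  exact (convex_ball _ _).isPreconnected.image _ (continuousOn_phiInv.mono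
    (ball_subset_closedBall.trans (closedBall_subset_closedBall (exp_neg_le_one hr))))

lemma bijOn_phi_levelInterior (hr : 0 ≤ r) :
    BijOn phi (levelInterior r) (ball 0 (Real.exp (-r))) := by
  rw [levelInterior_eq hr]
  refine ⟨fun z hz => mem_ball_zero_iff.2 hz.2,
    injOn_phi.mono fun z hz => mem_closedBall_zero_iff.2 hz.1, fun w hw => ?_⟩
  rw [mem_ball_zero_iff] at hw
  have hw1 : ‖w‖ ≤ 1 := hw.le.trans (exp_neg_le_one hr)
  exact ⟨phiInv w, ⟨norm_phiInv_le hw1, by rwa [phi_phiInv hw1]⟩, phi_phiInv hw1⟩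

lemma bijOn_phi_levelCurve (hr : 0 ≤ r) :
    BijOn phi (levelCurve r) (sphere 0 (Real.exp (-r))) := by
  refine ⟨fun z hz => mem_sphere_zero_iff_norm.2 hz.1, injOn_phi.mono (levelCurve_subset r),
    fun w hw => ?_⟩
  rw [mem_sphere_zero_iff_norm] at hw
  have hw1 : ‖w‖ ≤ 1 := hw.le.trans (exp_neg_le_one hr)
  exact ⟨phiInv w, ⟨by rwa [phi_phiInv hw1], norm_phiInv_le hw1⟩, phi_phiInv hw1⟩

end Szego

/-! ### Complex-valued absolutely continuous functions -/

namespace AbsolutelyContinuousOnInterval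

open Set Filter Topology

/-- Absolute continuity passes through Lipschitz maps; the maps needed are real and imaginary parts,
`exp` and `phi`. -/
lemma of_dist_le {X Y : Type*} [PseudoMetricSpace X] [PseudoMetricSpace Y] {f : ℝ → X} {g : ℝ → Y}
    {a b K : ℝ} (hf : AbsolutelyContinuousOnInterval f a b)
    (h : ∀ x ∈ uIcc a b, ∀ y ∈ uIcc a b, dist (g x) (g y) ≤ K * dist (f x) (f y)) :
    AbsolutelyContinuousOnInterval g a b := by
  refine squeeze_zero' (Eventually.of_forall fun E => Finset.sum_nonneg fun _ _ => dist_nonneg) ?_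
    (by simpa using Tendsto.const_mul K hf)
  filter_upwards [mem_inf_of_right (mem_principal_self _)] with E hE
  rw [Finset.mul_sum]
  exact Finset.sum_le_sum fun i hi => h _ (hE.1 i hi).1 _ (hE.1 i hi).2

lemma congr {X : Type*} [PseudoMetricSpace X] {f g : ℝ → X} {a b : ℝ}
    (hf : AbsolutelyContinuousOnInterval f a b) (h : EqOn g f (uIcc a b)) :
    AbsolutelyContinuousOnInterval g a b :=
  hf.of_dist_le (K := 1) fun x hx y hy => by rw [h hx, h hy, one_mul]

lemma intervalIntegrable_ofReal {g : ℝ → ℝ} {a b : ℝ} (hg : IntervalIntegrable g volume a b) :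
    IntervalIntegrable (fun t => (g t : ℂ)) volume a b :=
  ⟨hg.1.ofReal, hg.2.ofReal⟩

variable {f : ℝ → ℂ} {a b : ℝ}

lemma re (hf : AbsolutelyContinuousOnInterval f a b) :
    AbsolutelyContinuousOnInterval (fun t => (f t).re) a b :=
  hf.of_dist_le (K := 1) fun x _ y _ => by
    rw [one_mul, Real.dist_eq, Complex.dist_eq, ← Complex.sub_re]
    exact Complex.abs_re_le_norm _

lemma im (hf : AbsolutelyContinuousOnInterval f a b) :
    AbsolutelyContinuousOnInterval (fun t => (f t).im) a b :=
  hf.of_dist_le (K := 1) fun x _ y _ => by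
    rw [one_mul, Real.dist_eq, Complex.dist_eq, ← Complex.sub_im]
    exact Complex.abs_im_le_norm _

lemma of_re_im (hre : AbsolutelyContinuousOnInterval (fun t => (f t).re) a b)
    (him : AbsolutelyContinuousOnInterval (fun t => (f t).im) a b) :
    AbsolutelyContinuousOnInterval f a b := by
  have h1 : AbsolutelyContinuousOnInterval (fun t => ((f t).re : ℂ)) a b :=
    hre.of_dist_le (K := 1) fun x _ y _ => by
      simp [Complex.dist_eq, Real.dist_eq, ← Complex.ofReal_sub]
  have h2 : AbsolutelyContinuousOnInterval (fun t => ((f t).im : ℂ)) a b :=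
    him.of_dist_le (K := 1) fun x _ y _ => by
      simp [Complex.dist_eq, Real.dist_eq, ← Complex.ofReal_sub]
  refine (h1.add (h2.const_smul Complex.I)).congr fun t _ => ?_
  simp only [Pi.add_apply, smul_eq_mul, mul_comm Complex.I]
  exact (Complex.re_add_im (f t)).symm

lemma ae_hasDerivAt_complex (hf : AbsolutelyContinuousOnInterval f a b) :
    ∀ᵐ x : ℝ, x ∈ uIcc a b →
      HasDerivAt f (deriv (fun t => (f t).re) x + deriv (fun t => (f t).im) x * Complex.I) x := by
  filter_upwards [hf.re.ae_differentiableAt, hf.im.ae_differentiableAt] with x h1 h2 hx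
  have h := (h1 hx).hasDerivAt.ofReal_comp.add ((h2 hx).hasDerivAt.ofReal_comp.mul_const Complex.I)
  exact h.congr_of_eventuallyEq (Eventually.of_forall fun t => (Complex.re_add_im (f t)).symm)

lemma ae_hasDerivAt_deriv (hf : AbsolutelyContinuousOnInterval f a b) :
    ∀ᵐ x : ℝ, x ∈ uIcc a b → HasDerivAt f (deriv f x) x := by
  filter_upwards [hf.ae_hasDerivAt_complex] with x h hx
  exact (h hx).differentiableAt.hasDerivAt

lemma intervalIntegrable_deriv_complex (hf : AbsolutelyContinuousOnInterval f a b) :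
    IntervalIntegrable (deriv f) volume a b := by
  have h1 : IntervalIntegrable (fun x => ((deriv (fun t => (f t).re) x : ℝ) : ℂ) +
      deriv (fun t => (f t).im) x * Complex.I) volume a b :=
    (intervalIntegrable_ofReal hf.re.intervalIntegrable_deriv).add
      ((intervalIntegrable_ofReal hf.im.intervalIntegrable_deriv).mul_const _)
  refine h1.congr_ae ?_
  rw [EventuallyEq, ae_restrict_iff' measurableSet_uIoc]
  filter_upwards [hf.ae_hasDerivAt_complex] with x h hx
  exact (h (uIoc_subset_uIcc hx)).deriv.symm

lemma integral_deriv_eq_sub_complex (hf : AbsolutelyContinuousOnInterval f a b) :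
    ∫ x in a..b, deriv f x = f b - f a := by
  have h1 : ∫ x in a..b, deriv f x = ∫ x in a..b, (((deriv (fun t => (f t).re) x : ℝ) : ℂ) +
      deriv (fun t => (f t).im) x * Complex.I) := by
    refine intervalIntegral.integral_congr_ae ?_
    filter_upwards [hf.ae_hasDerivAt_complex] with x h hx
    exact (h (uIoc_subset_uIcc hx)).deriv
  rw [h1, intervalIntegral.integral_add (intervalIntegrable_ofReal hf.re.intervalIntegrable_deriv)
    ((intervalIntegrable_ofReal hf.im.intervalIntegrable_deriv).mul_const _), intervalIntegral.integral_mul_const,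
    intervalIntegral.integral_ofReal, intervalIntegral.integral_ofReal,
    hf.re.integral_deriv_eq_sub, hf.im.integral_deriv_eq_sub]
  apply Complex.ext <;> simp

end AbsolutelyContinuousOnInterval

open Set in
lemma IntervalIntegrable.absolutelyContinuousOnInterval_integral_complex {f : ℝ → ℂ} {a b : ℝ}
    (h : IntervalIntegrable f volume a b) :
    AbsolutelyContinuousOnInterval (fun x => ∫ v in a..x, f v) a b := by
  have hx : ∀ x ∈ uIcc a b, IntervalIntegrable f volume a x := fun x hx =>
    h.mono_set (uIcc_subset_uIcc_left hx)
  have hre : IntervalIntegrable (fun t => (f t).re) volume a b :=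
    ⟨h.1.re, h.2.re⟩
  have him : IntervalIntegrable (fun t => (f t).im) volume a b :=
    ⟨h.1.im, h.2.im⟩
  refine .of_re_im ((hre.absolutelyContinuousOnInterval_intervalIntegral left_mem_uIcc).congr
    fun x hx' => ?_) ((him.absolutelyContinuousOnInterval_intervalIntegral left_mem_uIcc).congr
    fun x hx' => ?_)
  · exact (Complex.reCLM.intervalIntegral_comp_comm (hx x hx')).symm
  · exact (Complex.imCLM.intervalIntegral_comp_comm (hx x hx')).symm

open Set Filter Topology in
/-- Integration by substitution for a strictly increasing absolutely continuous function `α` with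
derivative `g`: the image of the measure `g(t) dt` under `α` is Lebesgue measure. -/
lemma MeasureTheory.map_withDensity_of_strictMonoOn {α g : ℝ → ℝ} {a b : ℝ} (hab : a ≤ b)
    (hc : ContinuousOn α (Icc a b)) (hmono : StrictMonoOn α (Icc a b))
    (hg : IntervalIntegrable g volume a b) (hg0 : ∀ᵐ t ∂volume.restrict (Ioc a b), 0 ≤ g t)
    (hfint : ∀ t ∈ Icc a b, ∫ x in a..t, g x = α t - α a) :
    ((volume.restrict (Ioc a b)).withDensity fun t => ENNReal.ofReal (g t)).map α =
      volume.restrict (Ioc (α a) (α b)) := by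
  have haa : a ∈ Icc a b := left_mem_Icc.2 hab
  have hbb : b ∈ Icc a b := right_mem_Icc.2 hab
  have hgi : Integrable g (volume.restrict (Ioc a b)) := hg.1
  have hfin : IsFiniteMeasure ((volume.restrict (Ioc a b)).withDensity
      fun t => ENNReal.ofReal (g t)) :=
    isFiniteMeasure_withDensity_ofReal hgi.2
  have hαm : AEMeasurable α ((volume.restrict (Ioc a b)).withDensity
      fun t => ENNReal.ofReal (g t)) :=
    ((hc.aemeasurable measurableSet_Icc).mono_measure
      (Measure.restrict_mono Ioc_subset_Icc_self le_rfl)).mono_ac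
        (withDensity_absolutelyContinuous _ _)
  have hl : ∀ t ∈ Icc a b, ∫⁻ x in Ioc a t, ENNReal.ofReal (g x) = ENNReal.ofReal (α t - α a) := by
    intro t ht
    have hsub : Ioc a t ⊆ Ioc a b := Ioc_subset_Ioc_right ht.2
    rw [← hfint t ht, intervalIntegral.integral_of_le ht.1,
      ofReal_integral_eq_lintegral_ofReal (hgi.mono_measure (Measure.restrict_mono hsub le_rfl))
        (ae_mono (Measure.restrict_mono hsub le_rfl) hg0)]
  -- The measures are compared on half-lines `Iic c`, whose preimages under a strictly increasing
  -- function are initial intervals.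
  have key : ∀ c, ∀ t ∈ Icc a b, α ⁻¹' Iic c ∩ Ioc a b = Ioc a t →
      (((volume.restrict (Ioc a b)).withDensity fun t => ENNReal.ofReal (g t)).map α) (Iic c) =
        ENNReal.ofReal (α t - α a) := by
    intro c t ht h
    rw [Measure.map_apply_of_aemeasurable hαm measurableSet_Iic,
      ← restrict_withDensity measurableSet_Ioc, Measure.restrict_apply' measurableSet_Ioc, h,
      withDensity_apply _ measurableSet_Ioc, hl t ht]
  refine Measure.ext_of_Iic _ _ fun c => ?_
  rw [Measure.restrict_apply measurableSet_Iic, inter_comm, Ioc_inter_Iic, Real.volume_Ioc]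
  rcases lt_or_ge c (α a) with h1 | h1
  · rw [key c a haa]
    · rw [sub_self, ENNReal.ofReal_zero, ENNReal.ofReal_of_nonpos]
      linarith [min_le_right (α b) c]
    · rw [Ioc_self]
      refine eq_empty_of_forall_notMem fun t ht => ?_
      have := hmono.monotoneOn haa (Ioc_subset_Icc_self ht.2) ht.2.1.le
      have h2 : α t ≤ c := ht.1
      linarith
  rcases lt_or_ge (α b) c with h2 | h2
  · rw [key c b hbb, min_eq_left h2.le]
    refine inter_eq_right.2 fun t ht => ?_
    exact (hmono.monotoneOn (Ioc_subset_Icc_self ht) hbb ht.2).trans h2.le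
  · obtain ⟨t, ht, rfl⟩ := intermediate_value_Icc hab hc ⟨h1, h2⟩
    rw [key _ t ht, min_eq_right h2]
    ext s
    constructor
    · rintro ⟨hs1, hs2⟩
      exact ⟨hs2.1, (hmono.le_iff_le (Ioc_subset_Icc_self hs2) ht).1 hs1⟩
    · rintro ⟨hs1, hs2⟩
      have hs : s ∈ Ioc a b := ⟨hs1, hs2.trans ht.2⟩
      exact ⟨(hmono.le_iff_le (Ioc_subset_Icc_self hs) ht).2 hs2, hs⟩

/-! ### The circle measure transported to the level curve -/

namespace Szego

open Complex Metric Set Filter Topology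

variable {r : ℝ}

/-- The parametrization `θ ↦ φ⁻¹(e^{-r + iθ})` of the level curve. -/
noncomputable def levelParam (r θ : ℝ) : ℂ := phiInv (circleMap 0 (Real.exp (-r)) θ)

lemma norm_circleMap_exp (r θ : ℝ) : ‖circleMap 0 (Real.exp (-r)) θ‖ = Real.exp (-r) := by
  rw [norm_circleMap_zero, abs_of_pos (Real.exp_pos _)]

lemma norm_circleMap_exp_le (hr : 0 ≤ r) (θ : ℝ) : ‖circleMap 0 (Real.exp (-r)) θ‖ ≤ 1 :=
  (norm_circleMap_exp r θ).trans_le (exp_neg_le_one hr)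

lemma phi_levelParam (hr : 0 ≤ r) (θ : ℝ) :
    phi (levelParam r θ) = circleMap 0 (Real.exp (-r)) θ :=
  phi_phiInv (norm_circleMap_exp_le hr θ)

lemma continuous_levelParam (hr : 0 ≤ r) : Continuous (levelParam r) :=
  continuousOn_phiInv.comp_continuous (continuous_circleMap _ _)
    fun θ => mem_closedBall_zero_iff.2 (norm_circleMap_exp_le hr θ)

lemma periodic_levelParam (r : ℝ) : Function.Periodic (levelParam r) (2 * Real.pi) := fun θ => by
  rw [levelParam, periodic_circleMap, levelParam]

lemma levelParam_mem (hr : 0 ≤ r) (θ : ℝ) : levelParam r θ ∈ levelCurve r :=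
  ⟨by rw [phi_levelParam hr, norm_circleMap_exp], norm_phiInv_le (norm_circleMap_exp_le hr θ)⟩

/-- The image of normalized arc length under the parametrization of the level curve. -/
noncomputable def levelMeasure (r : ℝ) : Measure ℂ :=
  (ENNReal.ofReal (2 * Real.pi))⁻¹ •
    (volume.restrict (Ioc 0 (2 * Real.pi))).map (levelParam r)

lemma levelMeasure_apply (hr : 0 ≤ r) {A : Set ℂ} (hA : MeasurableSet A) :
    levelMeasure r A = (ENNReal.ofReal (2 * Real.pi))⁻¹ *
      volume (levelParam r ⁻¹' A ∩ Ioc 0 (2 * Real.pi)) := by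
  rw [levelMeasure, Measure.smul_apply, smul_eq_mul,
    Measure.map_apply (continuous_levelParam hr).measurable hA,
    Measure.restrict_apply ((continuous_levelParam hr).measurable hA)]

lemma isProbabilityMeasure_levelMeasure (hr : 0 ≤ r) : IsProbabilityMeasure (levelMeasure r) := by
  refine ⟨?_⟩
  rw [levelMeasure_apply hr MeasurableSet.univ, preimage_univ, univ_inter, Real.volume_Ioc,
    sub_zero]
  exact ENNReal.inv_mul_cancel (by simpa using Real.pi_pos) ENNReal.ofReal_ne_top

lemma levelMeasure_compl (hr : 0 ≤ r) : levelMeasure r (levelCurve r)ᶜ = 0 := by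
  rw [levelMeasure_apply hr (isCompact_levelCurve r).measurableSet.compl]
  have : levelParam r ⁻¹' (levelCurve r)ᶜ = ∅ :=
    eq_empty_of_forall_notMem fun θ h => h (levelParam_mem hr θ)
  simp [this]

lemma levelMeasure_eq_circleArcLength (hr : 0 ≤ r) {A : Set ℂ} (hA : A ⊆ levelCurve r)
    (hAm : MeasurableSet A) :
    levelMeasure r A = circleArcLength (Real.exp (-r)) (phi '' A) := by
  have hinj : InjOn phi A := injOn_phi.mono (hA.trans (levelCurve_subset r))
  -- An injective continuous image of a Borel set is Borel.
  have him : MeasurableSet (phi '' A) := hAm.image_of_continuousOn_injOn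
    continuous_phi.continuousOn hinj
  have hcm := (continuous_circleMap 0 (Real.exp (-r))).measurable
  rw [levelMeasure_apply hr hAm, circleArcLength, Measure.smul_apply, smul_eq_mul,
    Measure.map_apply hcm him, Measure.restrict_apply (hcm him)]
  congr 3
  ext θ
  simp only [mem_preimage, mem_image]
  constructor
  · exact fun h => ⟨_, h, phi_levelParam hr θ⟩
  · rintro ⟨z, hz, h⟩
    rwa [levelParam, ← h, phiInv_phi (hA hz).2]

/-! ### The logarithmic derivative of `phi` along a contour -/

section Contour

variable {x : ℂ} {γ : Path x x}

lemma extend_mem_levelCurve (hγ : IsPositiveContour γ (levelCurve r)) (t : ℝ) :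
    γ.extend t ∈ levelCurve r := by
  have h : γ.extend t ∈ range γ.extend := mem_range_self t
  rwa [Path.extend_range, hγ.trace] at h

lemma extend_ne_zero (hγ : IsPositiveContour γ (levelCurve r)) (t : ℝ) : γ.extend t ≠ 0 :=
  fun h => zero_notMem_levelCurve r (h ▸ extend_mem_levelCurve hγ t)

lemma continuous_one_sub_div_extend (hγ : IsPositiveContour γ (levelCurve r)) :
    Continuous fun t => (1 - γ.extend t) / γ.extend t :=
  (continuous_const.sub γ.continuous_extend).div γ.continuous_extend (extend_ne_zero hγ)

/-- The logarithmic derivative of `φ ∘ γ`. -/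
noncomputable def contourLogDeriv {x : ℂ} (γ : Path x x) (t : ℝ) : ℂ :=
  (1 - γ.extend t) / γ.extend t * deriv γ.extend t

lemma intervalIntegrable_contourLogDeriv (hγ : IsPositiveContour γ (levelCurve r)) :
    IntervalIntegrable (contourLogDeriv γ) volume 0 1 :=
  hγ.absolutelyContinuous.intervalIntegrable_deriv_complex.continuousOn_mul
    (continuous_one_sub_div_extend hγ).continuousOn

/-- Since `(1 - z)/z = 1/z - 1`, the first term gives the winding number about `0` and the second
vanishes on a closed curve. -/
lemma intervalIntegral_contourLogDeriv (hr : 0 ≤ r) (hγ : IsPositiveContour γ (levelCurve r)) :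
    ∫ t in (0 : ℝ)..1, contourLogDeriv γ t = 2 * Real.pi * I := by
  have hd := hγ.absolutelyContinuous.intervalIntegrable_deriv_complex
  have hw := hγ.counterclockwise 0 (zero_mem_levelInterior hr)
  simp only [windingNumber, sub_zero] at hw
  have hpi : (2 * Real.pi * I : ℂ) ≠ 0 := Complex.two_pi_I_ne_zero
  rw [inv_mul_eq_one₀ hpi] at hw
  have h1 : ∀ t, contourLogDeriv γ t = deriv γ.extend t / γ.extend t - deriv γ.extend t := by
    intro t
    have := extend_ne_zero hγ t
    rw [contourLogDeriv]
    field_simp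
  have hi : IntervalIntegrable (fun t => deriv γ.extend t / γ.extend t) volume 0 1 := by
    simp only [div_eq_mul_inv]
    exact hd.mul_continuousOn (γ.continuous_extend.inv₀ (extend_ne_zero hγ)).continuousOn
  simp only [h1]
  rw [intervalIntegral.integral_sub hi hd, ← hw,
    hγ.absolutelyContinuous.integral_deriv_eq_sub_complex, Path.extend_one, Path.extend_zero,
    sub_self, sub_zero]

/-- The product of `φ ∘ γ` and `e^{-a}` has derivative zero almost everywhere. Absolute continuity
of both factors is what makes it constant. -/
lemma phi_extend_eq (hγ : IsPositiveContour γ (levelCurve r)) {t : ℝ} (ht : t ∈ Icc (0 : ℝ) 1) :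
    phi (γ.extend t) = phi x * exp (∫ s in (0 : ℝ)..t, contourLogDeriv γ s) := by
  have hI := intervalIntegrable_contourLogDeriv hγ
  set a : ℝ → ℂ := fun t => ∫ s in (0 : ℝ)..t, contourLogDeriv γ s with ha
  have haAC : AbsolutelyContinuousOnInterval a 0 1 :=
    hI.absolutelyContinuousOnInterval_integral_complex
  obtain ⟨M, hM⟩ := haAC.exists_bound
  have hexpAC : AbsolutelyContinuousOnInterval (fun t => exp (-a t)) 0 1 := by
    refine haAC.of_dist_le (K := Real.exp M) fun u hu v hv => ?_
    have := (convex_closedBall (0 : ℂ) M).norm_image_sub_le_of_norm_hasDerivWithin_le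
      (f := exp) (f' := exp) (C := Real.exp M)
      (fun z _ => (Complex.hasDerivAt_exp z).hasDerivWithinAt) (fun z hz => ?_)
      (x := -a v) (y := -a u) (by simpa using hM v hv) (by simpa using hM u hu)
    · rwa [dist_eq_norm, dist_eq_norm, ← norm_neg (a u - a v), neg_sub', sub_neg_eq_add,
        ← sub_neg_eq_add]
    · rw [Complex.norm_exp]
      exact Real.exp_le_exp.2 ((re_le_norm z).trans (mem_closedBall_zero_iff.1 hz))
  have hphiAC : AbsolutelyContinuousOnInterval (fun t => phi (γ.extend t)) 0 1 := by
    refine hγ.absolutelyContinuous.of_dist_le (K := Real.exp 2 * 2) fun u _ v _ => ?_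
    rw [dist_eq_norm, dist_eq_norm]
    exact norm_phi_sub_phi_le (extend_mem_levelCurve hγ u).2 (extend_mem_levelCurve hγ v).2
  obtain ⟨C, hC⟩ := (hphiAC.fun_smul hexpAC).const_of_ae_hasDerivAt_zero (by
    filter_upwards [hγ.absolutelyContinuous.ae_hasDerivAt_deriv, hI.ae_hasDerivAt_integral]
      with u h1 h2 hu
    have h3 := (hasDerivAt_phi (γ.extend u)).comp u (h1 hu)
    have h4 : HasDerivAt (fun t => exp (-a t)) (exp (-a u) * -contourLogDeriv γ u) u :=
      (h2 hu 0 left_mem_uIcc).neg.cexp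
    refine (h3.mul h4).congr_deriv ?_
    have h0 := extend_ne_zero hγ u
    simp only [contourLogDeriv, Function.comp, phi]
    field_simp
    ring)
  rw [uIcc_of_le zero_le_one] at hC
  have h0 := hC 0 (by simp)
  have h1 := hC t ht
  rw [← h0] at h1
  simp only [ha, smul_eq_mul, intervalIntegral.integral_same, neg_zero, Complex.exp_zero, mul_one,
    Path.extend_zero] at h1
  rw [← h1, mul_assoc, ← Complex.exp_add, neg_add_cancel, Complex.exp_zero, mul_one]

end Contour

end Szego

/-! ### The argument of `phi` along a contour, and independence of the parametrization -/

namespace Szego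

open Complex Metric Set Filter Topology

variable {r : ℝ} {x : ℂ} {γ : Path x x}

/-- The increment of the argument of `φ ∘ γ`. -/
noncomputable def contourArg {x : ℂ} (γ : Path x x) (t : ℝ) : ℝ :=
  ∫ s in (0 : ℝ)..t, (contourLogDeriv γ s).im

lemma intervalIntegrable_im_contourLogDeriv (hγ : IsPositiveContour γ (levelCurve r)) :
    IntervalIntegrable (fun s => (contourLogDeriv γ s).im) volume 0 1 :=
  have h := intervalIntegrable_contourLogDeriv hγ
  ⟨h.1.im, h.2.im⟩

/-- Because `|φ| = e^{-r}` along the contour, the exponential in `phi_extend_eq` has modulus `1`. -/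
lemma integral_contourLogDeriv_eq (hγ : IsPositiveContour γ (levelCurve r)) {t : ℝ}
    (ht : t ∈ Icc (0 : ℝ) 1) : ∫ s in (0 : ℝ)..t, contourLogDeriv γ s = contourArg γ t * I := by
  have hi : IntervalIntegrable (contourLogDeriv γ) volume 0 t :=
    (intervalIntegrable_contourLogDeriv hγ).mono_set (by
      rw [uIcc_of_le ht.1, uIcc_of_le zero_le_one]; exact Icc_subset_Icc_right ht.2)
  have him : (∫ s in (0 : ℝ)..t, contourLogDeriv γ s).im = contourArg γ t :=
    (imCLM.intervalIntegral_comp_comm hi).symm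
  have hre : (∫ s in (0 : ℝ)..t, contourLogDeriv γ s).re = 0 := by
    have h := congrArg norm (phi_extend_eq hγ ht)
    have hx : ‖phi x‖ = Real.exp (-r) := by
      simpa using (extend_mem_levelCurve hγ 0).1
    rw [norm_mul, (extend_mem_levelCurve hγ t).1, hx, Complex.norm_exp] at h
    have := mul_left_cancel₀ (Real.exp_pos (-r)).ne' ((mul_one _).trans h)
    exact (Real.exp_eq_one_iff _).1 this.symm
  apply Complex.ext <;> simp [him, hre]

lemma contourArg_zero (γ : Path x x) : contourArg γ 0 = 0 := intervalIntegral.integral_same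

lemma contourArg_one (hr : 0 ≤ r) (hγ : IsPositiveContour γ (levelCurve r)) :
    contourArg γ 1 = 2 * Real.pi := by
  have h := integral_contourLogDeriv_eq hγ (t := 1) (by simp)
  rw [intervalIntegral_contourLogDeriv hr hγ] at h
  have := mul_right_cancel₀ I_ne_zero h
  exact_mod_cast this.symm

lemma phi_extend_eq_contourArg (hγ : IsPositiveContour γ (levelCurve r)) {t : ℝ}
    (ht : t ∈ Icc (0 : ℝ) 1) :
    phi (γ.extend t) = circleMap 0 (Real.exp (-r)) ((phi x).arg + contourArg γ t) := by
  have hx : ‖phi x‖ = Real.exp (-r) := by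
    simpa using (extend_mem_levelCurve hγ 0).1
  rw [phi_extend_eq hγ ht, integral_contourLogDeriv_eq hγ ht, circleMap, zero_add, ofReal_add,
    add_mul, Complex.exp_add, ← mul_assoc, ← hx, norm_mul_exp_arg_mul_I]

lemma extend_eq_levelParam (hγ : IsPositiveContour γ (levelCurve r)) {t : ℝ}
    (ht : t ∈ Icc (0 : ℝ) 1) :
    γ.extend t = levelParam r ((phi x).arg + contourArg γ t) := by
  rw [levelParam, ← phi_extend_eq_contourArg hγ ht, phiInv_phi (extend_mem_levelCurve hγ t).2]

lemma continuousOn_contourArg (hγ : IsPositiveContour γ (levelCurve r)) :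
    ContinuousOn (contourArg γ) (Icc 0 1) := by
  have := ((intervalIntegrable_im_contourLogDeriv hγ).absolutelyContinuousOnInterval_intervalIntegral
    (c := 0) left_mem_uIcc).continuousOn
  rwa [uIcc_of_le zero_le_one] at this

/-- Equal arguments give equal points of the curve, so simplicity makes the argument injective; a
continuous injective function with larger value at `1` than at `0` increases. -/
lemma strictMonoOn_contourArg (hr : 0 ≤ r) (hγ : IsPositiveContour γ (levelCurve r)) :
    StrictMonoOn (contourArg γ) (Icc 0 1) := by
  have hpos := Real.two_pi_pos
  -- Simplicity covers only `[0, 1)`. At the endpoint, a coincidence would force `s = 0`, but the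
  -- argument runs from `0` to `2π`.
  have heq : ∀ s ∈ Icc (0 : ℝ) 1, contourArg γ s = contourArg γ 1 → s = 1 := by
    intro s hs h
    by_contra hne
    have hs1 : s ∈ Ico (0 : ℝ) 1 := ⟨hs.1, hs.2.lt_of_ne hne⟩
    have h1 : γ.extend s = γ.extend 0 := by
      rw [extend_eq_levelParam hγ hs, h, ← extend_eq_levelParam hγ (by simp), Path.extend_one,
        Path.extend_zero]
    have h2 := hγ.simple hs1 (by simp) h1
    rw [h2, contourArg_zero, contourArg_one hr hγ] at h
    linarith
  refine ContinuousOn.strictMonoOn_of_injOn_Icc zero_le_one ?_ (continuousOn_contourArg hγ) ?_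
  · rw [contourArg_zero, contourArg_one hr hγ]; exact hpos.le
  · intro s hs t ht h
    rcases hs.2.eq_or_lt with rfl | hs1
    · exact (heq t ht h.symm).symm
    rcases ht.2.eq_or_lt with rfl | ht1
    · exact heq s hs h
    refine hγ.simple ⟨hs.1, hs1⟩ ⟨ht.1, ht1⟩ ?_
    rw [extend_eq_levelParam hγ hs, extend_eq_levelParam hγ ht, h]

/-- This is the positivity of the measure: the identity for the integral is differentiated almost
everywhere, and an increasing function has nonnegative derivative. -/
lemma ae_contourLogDeriv (hr : 0 ≤ r) (hγ : IsPositiveContour γ (levelCurve r)) :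
    ∀ᵐ t ∂volume.restrict (Ioc (0 : ℝ) 1),
      contourLogDeriv γ t = (contourLogDeriv γ t).im * I ∧ 0 ≤ (contourLogDeriv γ t).im := by
  rw [ae_restrict_iff' measurableSet_Ioc]
  have hne : ∀ᵐ t : ℝ, t ≠ 1 := by simp [ae_iff, measure_singleton]
  filter_upwards [(intervalIntegrable_contourLogDeriv hγ).ae_hasDerivAt_integral,
    (intervalIntegrable_im_contourLogDeriv hγ).ae_hasDerivAt_integral, hne] with t h1 h2 h3 ht
  have hti : t ∈ Ioo (0 : ℝ) 1 := ⟨ht.1, ht.2.lt_of_ne h3⟩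
  have htu : t ∈ uIcc (0 : ℝ) 1 := by rw [uIcc_of_le zero_le_one]; exact Ioo_subset_Icc_self hti
  have hd := h1 htu 0 left_mem_uIcc
  have hd' : HasDerivAt (contourArg γ) _ t := h2 htu 0 left_mem_uIcc
  constructor
  · refine hd.unique ((hd'.ofReal_comp.mul_const I).congr_of_eventuallyEq ?_)
    filter_upwards [isOpen_Ioo.mem_nhds hti] with s hs
    exact integral_contourLogDeriv_eq hγ (Ioo_subset_Icc_self hs)
  · rw [← hd'.deriv, ← derivWithin_of_mem_nhds (Icc_mem_nhds hti.1 hti.2)]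
    exact (strictMonoOn_contourArg hr hγ).monotoneOn.derivWithin_nonneg

/-- Translations do not change the part of a `2π`-periodic set in one period. -/
lemma volume_preimage_add_levelParam (hr : 0 ≤ r) (θ : ℝ) {A : Set ℂ} (hA : MeasurableSet A) :
    volume ((fun s => levelParam r (θ + s)) ⁻¹' A ∩ Ioc 0 (2 * Real.pi)) =
      volume (levelParam r ⁻¹' A ∩ Ioc 0 (2 * Real.pi)) := by
  have hm : MeasurableSet (levelParam r ⁻¹' A) := (continuous_levelParam hr).measurable hA
  have h1 : volume ((fun s => levelParam r (θ + s)) ⁻¹' A ∩ Ioc 0 (2 * Real.pi)) =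
      volume (levelParam r ⁻¹' A ∩ Ioc θ (θ + 2 * Real.pi)) := by
    rw [← measure_preimage_add volume θ (levelParam r ⁻¹' A ∩ Ioc θ (θ + 2 * Real.pi))]
    congr 1
    ext s
    simp
  rw [h1]
  -- The shift is carried out on integrals of the indicator; finiteness of the volumes allows the
  -- return to measures.
  have h2 := (periodic_levelParam r).comp (fun z => A.indicator (fun _ => (1 : ℝ)) z)
  have h3 := h2.intervalIntegral_add_eq θ 0
  rw [zero_add, intervalIntegral.integral_of_le (by linarith [Real.two_pi_pos]),
    intervalIntegral.integral_of_le Real.two_pi_pos.le] at h3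
  have h4 : ∀ s : Set ℝ, ∫ t in s, (A.indicator (fun _ => (1 : ℝ)) ∘ levelParam r) t =
      (volume (levelParam r ⁻¹' A ∩ s)).toReal := by
    intro s
    have : (A.indicator (fun _ => (1 : ℝ)) ∘ levelParam r) =
        (levelParam r ⁻¹' A).indicator 1 := by
      ext t
      exact (indicator_comp_right (levelParam r)).symm
    rw [this, integral_indicator_one hm, measureReal_restrict_apply hm, Measure.real]
  have h5 : ∀ a b : ℝ, volume (levelParam r ⁻¹' A ∩ Ioc a b) ≠ ⊤ := fun a b =>
    ((measure_mono inter_subset_right).trans_lt measure_Ioc_lt_top).ne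
  have h6 := (h4 _).symm.trans (h3.trans (h4 _))
  exact (ENNReal.toReal_eq_toReal_iff' (h5 _ _) (h5 _ _)).1 h6

/-- The complex measure `(1 / 2πi) ((1 - z) / z) dz` along any positive contour is the image of
normalized arc length. -/
lemma lineMeasure_szegoDensity (hr : 0 ≤ r) (hγ : IsPositiveContour γ (levelCurve r)) {A : Set ℂ}
    (hA : MeasurableSet A) :
    lineMeasure szegoDensity γ A = (((levelMeasure r).real A : ℝ) : ℂ) := by
  set g : ℝ → ℝ := fun t => (contourLogDeriv γ t).im with hg
  have hgi : Integrable g (volume.restrict (Ioc (0 : ℝ) 1)) :=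
    (intervalIntegrable_im_contourLogDeriv hγ).1
  have hfm : Measurable γ.extend := γ.continuous_extend.measurable
  have hD : ∀ t, szegoDensity (γ.extend t) * deriv γ.extend t =
      (2 * Real.pi * I)⁻¹ * contourLogDeriv γ t := fun t => by
    rw [szegoDensity, contourLogDeriv, mul_assoc]
  have hfint : Integrable (fun t => szegoDensity (γ.extend t) * deriv γ.extend t)
      (volume.restrict (Ioc (0 : ℝ) 1)) := by
    simp only [hD]
    exact (intervalIntegrable_contourLogDeriv hγ).1.const_mul _
  have hae := ae_contourLogDeriv hr hγ
  have hg0 : ∀ᵐ t ∂volume.restrict (Ioc (0 : ℝ) 1), 0 ≤ g t := hae.mono fun t h => h.2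
  have hmap := map_withDensity_of_strictMonoOn zero_le_one (continuousOn_contourArg hγ)
    (strictMonoOn_contourArg hr hγ) (intervalIntegrable_im_contourLogDeriv hγ) hg0
    (fun t _ => by rw [contourArg_zero, sub_zero, contourArg])
  rw [contourArg_zero, contourArg_one hr hγ] at hmap
  have hαm : AEMeasurable (contourArg γ) ((volume.restrict (Ioc (0 : ℝ) 1)).withDensity
      fun t => ENNReal.ofReal (g t)) :=
    (((continuousOn_contourArg hγ).aemeasurable measurableSet_Icc).mono_measure
      (Measure.restrict_mono Ioc_subset_Icc_self le_rfl)).mono_ac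
        (withDensity_absolutelyContinuous _ _)
  have hshift : MeasurableSet ((fun s => levelParam r ((phi x).arg + s)) ⁻¹' A) :=
    ((continuous_levelParam hr).comp (continuous_const.add continuous_id)).measurable hA
  -- Substitution turns `g dt` into Lebesgue measure on `(0, 2π]`; the starting angle `arg φ(x)`
  -- disappears by periodicity.
  have hν : ((volume.restrict (Ioc (0 : ℝ) 1)).withDensity fun t => ENNReal.ofReal (g t))
      (γ.extend ⁻¹' A) = volume (levelParam r ⁻¹' A ∩ Ioc 0 (2 * Real.pi)) := by
    rw [← volume_preimage_add_levelParam hr (phi x).arg hA, ← Measure.restrict_apply hshift,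
      ← hmap, Measure.map_apply_of_aemeasurable hαm hshift, ← restrict_withDensity measurableSet_Ioc,
      Measure.restrict_apply' measurableSet_Ioc, Measure.restrict_apply' measurableSet_Ioc]
    congr 1
    ext t
    refine and_congr_left fun ht => ?_
    rw [mem_preimage, mem_preimage, mem_preimage,
      extend_eq_levelParam hγ (Ioc_subset_Icc_self ht)]
  rw [withDensity_apply _ (hfm hA), ← ofReal_integral_eq_lintegral_ofReal
    (hgi.mono_measure Measure.restrict_le_self) (ae_mono Measure.restrict_le_self hg0)] at hν
  have hnn : 0 ≤ ∫ t in γ.extend ⁻¹' A, g t ∂volume.restrict (Ioc (0 : ℝ) 1) :=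
    integral_nonneg_of_ae (ae_mono Measure.restrict_le_self hg0)
  -- The factor `I` produced here cancels the one in `1 / 2πi`.
  have hI : ∫ t in γ.extend ⁻¹' A, contourLogDeriv γ t ∂volume.restrict (Ioc (0 : ℝ) 1) =
      ((∫ t in γ.extend ⁻¹' A, g t ∂volume.restrict (Ioc (0 : ℝ) 1) : ℝ) : ℂ) * I := by
    rw [← integral_complex_ofReal, ← integral_mul_const]
    exact integral_congr_ae (ae_mono Measure.restrict_le_self (hae.mono fun t h => h.1))
  rw [lineMeasure, VectorMeasure.map_apply _ hfm hA, withDensityᵥ_apply hfint (hfm hA)]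
  simp only [hD]
  rw [integral_const_mul, hI, Measure.real, levelMeasure_apply hr hA, ← hν, ENNReal.toReal_mul,
    ENNReal.toReal_inv, ENNReal.toReal_ofReal Real.two_pi_pos.le, ENNReal.toReal_ofReal hnn]
  push_cast
  have := I_ne_zero
  have := Real.pi_pos.ne'
  field_simp

end Szego

namespace Szego

open Complex Metric Set Filter Topology

variable {r : ℝ}

/-! ### Existence of a positive contour -/

/-- The radial gap `ρ - R` is itself at most the distance on the right. This makes bounds on the
outer circle uniform over smaller radii. -/
lemma norm_circleMap_sub_le_two_mul {R ρ θ : ℝ} {w : ℂ} (hR : 0 ≤ R) (hRρ : R ≤ ρ)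
    (hw : ‖w‖ = ρ) : ‖w - circleMap 0 ρ θ‖ ≤ 2 * ‖w - circleMap 0 R θ‖ := by
  have h1 : ‖circleMap 0 R θ - circleMap 0 ρ θ‖ = ρ - R := by
    simp only [circleMap, zero_add]
    rw [← sub_mul, norm_mul, norm_exp_ofReal_mul_I, mul_one, ← ofReal_sub, norm_real,
      Real.norm_of_nonpos (by linarith)]
    ring
  have h2 : ρ - R ≤ ‖w - circleMap 0 R θ‖ := by
    have := norm_sub_norm_le w (circleMap 0 R θ)
    rwa [norm_circleMap_zero, abs_of_nonneg hR, hw] at this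
  have h3 := norm_sub_le_norm_sub_add_norm_sub w (circleMap 0 R θ) (circleMap 0 ρ θ)
  linarith

/-- On the unit circle the distance is `2 sin (θ/2)`; Jordan's inequality and `π ≤ 4` give the
quarter, and the factor `2` pays for the smaller radius. -/
lemma min_div_four_le_norm_one_sub_circleMap {R θ : ℝ} (hR : 0 ≤ R) (hR1 : R ≤ 1)
    (hθ : θ ∈ Ioo 0 (2 * Real.pi)) :
    min θ (2 * Real.pi - θ) / 4 ≤ ‖1 - circleMap 0 R θ‖ := by
  have h1 : ‖1 - circleMap 0 1 θ‖ = 2 * Real.sin (θ / 2) := by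
    rw [norm_sub_rev]
    have := norm_exp_I_mul_ofReal_sub_one θ
    rw [mul_comm] at this
    simp only [circleMap, zero_add, ofReal_one, one_mul]
    rw [this, Real.norm_of_nonneg]
    have := Real.sin_nonneg_of_nonneg_of_le_pi (x := θ / 2) (by linarith [hθ.1])
      (by linarith [hθ.2])
    linarith
  have h2 := norm_circleMap_sub_le_two_mul (θ := θ) (w := 1) hR hR1 norm_one
  have hpi4 := Real.pi_le_four
  have hpi := Real.pi_pos
  have h3 : ∀ y, 0 ≤ y → y / 4 ≤ 2 / Real.pi * (y / 2) := by
    intro y hy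
    rw [div_mul_div_comm, mul_comm Real.pi 2, mul_div_mul_left _ _ two_ne_zero]
    gcongr
  have h4 : min θ (2 * Real.pi - θ) / 4 ≤ Real.sin (θ / 2) := by
    rcases le_total θ Real.pi with h | h
    · have := Real.mul_le_sin (x := θ / 2) (by linarith [hθ.1]) (by linarith)
      have := h3 θ hθ.1.le
      linarith [min_le_left θ (2 * Real.pi - θ)]
    · have h5 := Real.mul_le_sin (x := (2 * Real.pi - θ) / 2) (by linarith [hθ.2]) (by linarith)
      have := h3 (2 * Real.pi - θ) (by linarith [hθ.2])
      rw [show (2 * Real.pi - θ) / 2 = Real.pi - θ / 2 by ring, Real.sin_pi_sub] at h5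
      rw [show (2 * Real.pi - θ) / 2 = Real.pi - θ / 2 by ring] at this
      linarith [min_le_right θ (2 * Real.pi - θ)]
  linarith

/-- An integrable majorant of `1 / |1 - φ⁻¹(R e^{iθ})|`, uniform in `R`. -/
noncomputable def invBound (θ : ℝ) : ℝ :=
  4 * (θ ^ (-(1 / 2) : ℝ) + (2 * Real.pi - θ) ^ (-(1 / 2) : ℝ))

lemma intervalIntegrable_invBound : IntervalIntegrable invBound volume 0 (2 * Real.pi) := by
  have h1 : IntervalIntegrable (fun x : ℝ => x ^ (-(1 / 2) : ℝ)) volume 0 (2 * Real.pi) :=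
    intervalIntegral.intervalIntegrable_rpow' (by norm_num)
  have h2 := h1.comp_sub_left (2 * Real.pi)
  rw [sub_zero, sub_self] at h2
  exact (h1.add h2.symm).const_mul 4

lemma circleMap_ne_one {R θ : ℝ} (hR : 0 ≤ R) (hR1 : R ≤ 1) (hθ : θ ∈ Ioo 0 (2 * Real.pi)) :
    circleMap 0 R θ ≠ 1 := by
  intro h
  have h1 := min_div_four_le_norm_one_sub_circleMap hR hR1 hθ
  rw [h, sub_self, norm_zero] at h1
  have : 0 < min θ (2 * Real.pi - θ) := lt_min hθ.1 (by linarith [hθ.2])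
  linarith

lemma norm_circleMap_zero_le_one {R : ℝ} (hR : 0 ≤ R) (hR1 : R ≤ 1) (θ : ℝ) :
    ‖circleMap 0 R θ‖ ≤ 1 := by
  rwa [norm_circleMap_zero, abs_of_nonneg hR]

lemma inv_norm_one_sub_phiInv_le {R θ : ℝ} (hR : 0 ≤ R) (hR1 : R ≤ 1)
    (hθ : θ ∈ Ioo 0 (2 * Real.pi)) :
    ‖1 - phiInv (circleMap 0 R θ)‖⁻¹ ≤ invBound θ := by
  have hw := norm_circleMap_zero_le_one hR hR1 θ
  have h1 := min_div_four_le_norm_one_sub_circleMap hR hR1 hθ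
  have h2 := norm_one_sub_le_phiInv hw
  have hpos : 0 < ‖1 - phiInv (circleMap 0 R θ)‖ :=
    norm_pos_iff.2 (sub_ne_zero.2 (phiInv_ne_one hw (circleMap_ne_one hR hR1 hθ)).symm)
  set m := ‖1 - phiInv (circleMap 0 R θ)‖
  -- The constant comes from `s ≤ 12 m² ≤ (4m)²`.
  have key : ∀ s, 0 < s → s / 4 ≤ 3 * m ^ 2 → m⁻¹ ≤ 4 * s ^ (-(1 / 2) : ℝ) := by
    intro s hs h
    rw [Real.rpow_neg hs.le, ← Real.sqrt_eq_rpow, ← div_eq_mul_inv, inv_eq_one_div,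
      div_le_div_iff₀ hpos (Real.sqrt_pos.2 hs), one_mul]
    exact Real.sqrt_le_iff.2 ⟨by positivity, by nlinarith⟩
  have hn1 : 0 ≤ θ ^ (-(1 / 2) : ℝ) := Real.rpow_nonneg hθ.1.le _
  have hn2 : 0 ≤ (2 * Real.pi - θ) ^ (-(1 / 2) : ℝ) := Real.rpow_nonneg (by linarith [hθ.2]) _
  rw [invBound]
  rcases le_total θ (2 * Real.pi - θ) with h | h
  · rw [min_eq_left h] at h1
    have := key θ hθ.1 (h1.trans h2)
    linarith
  · rw [min_eq_right h] at h1
    have := key (2 * Real.pi - θ) (by linarith [hθ.2]) (h1.trans h2)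
    linarith

lemma hasDerivAt_levelParam (hr : 0 ≤ r) {θ : ℝ} (hθ : θ ∈ Ioo 0 (2 * Real.pi)) :
    HasDerivAt (levelParam r) (levelParam r θ / (1 - levelParam r θ) * I) θ := by
  have hw := norm_circleMap_exp_le hr θ
  have h1 := circleMap_ne_one (Real.exp_pos (-r)).le (exp_neg_le_one hr) hθ
  refine ((hasDerivAt_phiInv hw h1).comp θ (hasDerivAt_circleMap 0 _ θ)).congr_deriv ?_
  rw [← mul_assoc, mul_comm _ (circleMap 0 _ θ), mul_inv_deriv_phi_phiInv hw, levelParam]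

/-- The parametrization of the level curve over the unit interval. -/
noncomputable def levelPath (hr : 0 ≤ r) : Path (levelParam r 0) (levelParam r 0) where
  toFun t := levelParam r (2 * Real.pi * t)
  continuous_toFun := (continuous_levelParam hr).comp (by fun_prop)
  source' := by simp
  target' := by
    have := periodic_levelParam r 0
    simpa using this

lemma levelPath_extend (hr : 0 ≤ r) {t : ℝ} (ht : t ∈ Icc (0 : ℝ) 1) :
    (levelPath hr).extend t = levelParam r (2 * Real.pi * t) :=
  Path.extend_apply _ ht

lemma two_pi_mul_mem_Ioo {t : ℝ} (ht : t ∈ Ioo (0 : ℝ) 1) :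
    2 * Real.pi * t ∈ Ioo 0 (2 * Real.pi) :=
  ⟨mul_pos Real.two_pi_pos ht.1, mul_lt_of_lt_one_right Real.two_pi_pos ht.2⟩

lemma hasDerivAt_levelPath (hr : 0 ≤ r) {t : ℝ} (ht : t ∈ Ioo (0 : ℝ) 1) :
    HasDerivAt (levelPath hr).extend ((2 * Real.pi * I) * (levelParam r (2 * Real.pi * t) /
      (1 - levelParam r (2 * Real.pi * t)))) t := by
  have h1 : HasDerivAt (fun t : ℝ => 2 * Real.pi * t) (2 * Real.pi) t := by
    simpa using (hasDerivAt_id t).const_mul (2 * Real.pi)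
  have h2 := (hasDerivAt_levelParam hr (two_pi_mul_mem_Ioo ht)).scomp t h1
  refine (h2.congr_deriv ?_).congr_of_eventuallyEq ?_
  · simp only [real_smul, ofReal_mul, ofReal_ofNat]
    ring
  · filter_upwards [isOpen_Ioo.mem_nhds ht] with s hs
    exact levelPath_extend hr (Ioo_subset_Icc_self hs)

/-- The path is the integral of its derivative: differentiability inside `(0, 1)`, continuity up to
the ends and the majorant `invBound` suffice, although for `r = 0` the derivative is unbounded at
the ends. -/
lemma absolutelyContinuous_levelPath (hr : 0 ≤ r) :
    AbsolutelyContinuousOnInterval (levelPath hr).extend 0 1 := by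
  set d : ℝ → ℂ := fun t => (2 * Real.pi * I) * (levelParam r (2 * Real.pi * t) /
      (1 - levelParam r (2 * Real.pi * t))) with hd
  have hB : IntervalIntegrable (fun t => 2 * Real.pi * invBound (2 * Real.pi * t)) volume 0 1 := by
    have := intervalIntegrable_invBound.comp_mul_left (c := 2 * Real.pi)
    rw [zero_div, div_self Real.two_pi_pos.ne'] at this
    exact this.const_mul _
  have hdi : IntervalIntegrable d volume 0 1 := by
    have hmeas : Measurable d := by
      have : Measurable fun t : ℝ => levelParam r (2 * Real.pi * t) :=
        ((continuous_levelParam hr).comp (by fun_prop)).measurable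
      exact (this.div (measurable_const.sub this)).const_mul _
    refine hB.mono_fun hmeas.aestronglyMeasurable ?_
    have hne : ∀ᵐ t : ℝ, t ≠ 1 := by simp [ae_iff, measure_singleton]
    rw [EventuallyLE, ae_restrict_iff' measurableSet_uIoc]
    filter_upwards [hne] with t ht1 ht
    rw [uIoc_of_le zero_le_one] at ht
    have hti : t ∈ Ioo (0 : ℝ) 1 := ⟨ht.1, ht.2.lt_of_ne ht1⟩
    have h1 := inv_norm_one_sub_phiInv_le (Real.exp_pos (-r)).le (exp_neg_le_one hr)
      (two_pi_mul_mem_Ioo hti)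
    refine le_trans ?_ (le_abs_self _)
    rw [hd, norm_mul, norm_div]
    have h2 : ‖(2 * Real.pi * I : ℂ)‖ = 2 * Real.pi := by
      simp [abs_of_pos Real.pi_pos]
    have h3 : ‖levelParam r (2 * Real.pi * t)‖ ≤ 1 := (levelParam_mem hr _).2
    rw [h2, div_eq_mul_inv]
    refine mul_le_mul_of_nonneg_left ?_ Real.two_pi_pos.le
    exact (mul_le_of_le_one_left (inv_nonneg.2 (norm_nonneg _)) h3).trans h1
  have hconst : AbsolutelyContinuousOnInterval (fun _ : ℝ => levelParam r 0) 0 1 :=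
    hdi.absolutelyContinuousOnInterval_integral_complex.of_dist_le (K := 0) fun _ _ _ _ => by simp
  refine (hdi.absolutelyContinuousOnInterval_integral_complex.add hconst).congr fun t ht => ?_
  rw [uIcc_of_le zero_le_one] at ht
  have := intervalIntegral.integral_eq_sub_of_hasDerivAt_of_le ht.1
    (levelPath hr).continuous_extend.continuousOn
    (fun s hs => hasDerivAt_levelPath hr ⟨hs.1, hs.2.trans_le ht.2⟩)
    (hdi.mono_set (by
      rw [uIcc_of_le ht.1, uIcc_of_le zero_le_one]; exact Icc_subset_Icc_right ht.2))
  simp only [Pi.add_apply, hd]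
  rw [this, Path.extend_zero, sub_add_cancel]

lemma injOn_levelPath (hr : 0 ≤ r) : InjOn (levelPath hr).extend (Ico 0 1) := by
  intro s hs t ht h
  rw [levelPath_extend hr (Ico_subset_Icc_self hs), levelPath_extend hr (Ico_subset_Icc_self ht)]
    at h
  have h1 := congrArg phi h
  rw [phi_levelParam hr, phi_levelParam hr] at h1
  have hpi := Real.two_pi_pos
  have hmem : ∀ u ∈ Ico (0 : ℝ) 1, 2 * Real.pi * u ∈ Ico 0 (2 * Real.pi) := fun u hu =>
    ⟨mul_nonneg hpi.le hu.1, mul_lt_of_lt_one_right hpi hu.2⟩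
  have h2 := injOn_circleMap_of_abs_sub_le' (Real.exp_pos (-r)).ne' (by simp) (hmem s hs)
    (hmem t ht) h1
  exact mul_left_cancel₀ hpi.ne' h2

lemma range_levelPath (hr : 0 ≤ r) : range (levelPath hr) = levelCurve r := by
  refine Subset.antisymm (range_subset_iff.2 fun t => levelParam_mem hr _) fun z hz => ?_
  have hmem : phi z ∈ circleMap 0 (Real.exp (-r)) '' Ioc 0 (2 * Real.pi) := by
    rw [image_circleMap_Ioc, abs_of_pos (Real.exp_pos _)]
    exact mem_sphere_zero_iff_norm.2 hz.1
  obtain ⟨θ, hθ, h⟩ := hmem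
  have hpi := Real.two_pi_pos
  refine ⟨⟨θ / (2 * Real.pi), div_nonneg hθ.1.le hpi.le, (div_le_one hpi).2 hθ.2⟩, ?_⟩
  change levelParam r (2 * Real.pi * (θ / (2 * Real.pi))) = z
  rw [mul_div_cancel₀ _ hpi.ne', levelParam, h, phiInv_phi hz.2]

/-- The argument principle for `φ⁻¹ - a` on a circle inside the unit disk. -/
lemma circleAverage_phiInv_div {R : ℝ} (hR1 : R < 1) {b : ℂ} (hb : ‖b‖ < R) :
    Real.circleAverage (fun w => phiInv w / ((1 - phiInv w) * (phiInv w - phiInv b))) 0 R = 1 := by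
  have hR : 0 < R := (norm_nonneg b).trans_lt hb
  have hne1 : ∀ w ∈ ball (0 : ℂ) 1, w ≠ 1 := fun w hw h => by simp [h] at hw
  have hW : ∀ w ∈ ball (0 : ℂ) 1,
      HasDerivAt phiInv (exp (1 - phiInv w) * (1 - phiInv w))⁻¹ w := fun w hw =>
    hasDerivAt_phiInv (mem_ball_zero_iff.1 hw).le (hne1 w hw)
  have hWne : ∀ w ∈ ball (0 : ℂ) 1, (exp (1 - phiInv w) * (1 - phiInv w))⁻¹ ≠ 0 := fun w hw =>
    inv_ne_zero (mul_ne_zero (Complex.exp_ne_zero _)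
      (sub_ne_zero.2 (phiInv_ne_one (mem_ball_zero_iff.1 hw).le (hne1 w hw)).symm))
  have hWd : DifferentiableOn ℂ phiInv (ball 0 1) := fun w hw =>
    (hW w hw).differentiableAt.differentiableWithinAt
  have hb1 : b ∈ ball (0 : ℂ) 1 := mem_ball_zero_iff.2 (hb.trans hR1)
  have hsne : ∀ w ∈ ball (0 : ℂ) 1, dslope phiInv b w ≠ 0 := by
    intro w hw
    rcases eq_or_ne w b with rfl | hwb
    · rw [dslope_same, (hW _ hw).deriv]
      exact hWne _ hw
    · rw [dslope_of_ne _ hwb, slope_def_field]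
      refine div_ne_zero (sub_ne_zero.2 fun h => hwb ?_) (sub_ne_zero.2 hwb)
      exact phiInv_injOn (ball_subset_closedBall hw) (ball_subset_closedBall hb1) h
  -- On the circle the integrand is `w / (w - b)` times this function, which is holomorphic with
  -- value `1` at `b`; Cauchy's formula evaluates the mean.
  have hg : DifferentiableOn ℂ (fun w => deriv phiInv w / dslope phiInv b w) (ball 0 1) :=
    (hWd.deriv isOpen_ball).div
      ((Complex.differentiableOn_dslope (isOpen_ball.mem_nhds hb1)).2 hWd) hsne
  have hdc : DiffContOnCl ℂ (fun w => deriv phiInv w / dslope phiInv b w) (ball 0 |R|) := by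
    refine (hg.mono ?_).diffContOnCl
    rw [abs_of_pos hR, closure_ball _ hR.ne']
    exact closedBall_subset_ball hR1
  have hmain := hdc.circleAverage_smul_div (w := b)
    (by rw [abs_of_pos hR]; exact mem_ball_zero_iff.2 hb)
  rw [dslope_same, div_self (by rw [(hW b hb1).deriv]; exact hWne b hb1)] at hmain
  refine (Real.circleAverage_congr_sphere fun w hw => ?_).trans hmain
  rw [abs_of_pos hR, mem_sphere_zero_iff_norm] at hw
  have hw1 : w ∈ ball (0 : ℂ) 1 := mem_ball_zero_iff.2 (hw.trans_lt hR1)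
  have hwb : w ≠ b := fun h => by rw [h] at hw; linarith
  have hwb' : w - b ≠ 0 := sub_ne_zero.2 hwb
  have hWb : phiInv w - phiInv b ≠ 0 := sub_ne_zero.2 fun h => hwb
    (phiInv_injOn (ball_subset_closedBall hw1) (ball_subset_closedBall hb1) h)
  have hmul := mul_inv_deriv_phi_phiInv (mem_ball_zero_iff.1 hw1).le
  simp only [smul_eq_mul, sub_zero]
  rw [dslope_of_ne _ hwb, slope_def_field, (hW w hw1).deriv, ← div_div, ← hmul]
  generalize (exp (1 - phiInv w) * (1 - phiInv w))⁻¹ = d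
  field_simp

/-- For `r = 0` the circle passes through the singular point `1`, so the value is reached from
smaller radii by dominated convergence. -/
lemma circleAverage_phiInv_div_exp (hr : 0 ≤ r) {b : ℂ} (hb : ‖b‖ < Real.exp (-r)) :
    Real.circleAverage (fun w => phiInv w / ((1 - phiInv w) * (phiInv w - phiInv b))) 0
      (Real.exp (-r)) = 1 := by
  set ρ := Real.exp (-r) with hρ
  have hρ1 : ρ ≤ 1 := exp_neg_le_one hr
  have hρ0 : 0 < ρ := Real.exp_pos _
  have hb1 : ‖b‖ ≤ 1 := hb.le.trans hρ1
  -- Radii above this midpoint keep `w` away from the zero `b` of the denominator.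
  set R₀ := (‖b‖ + ρ) / 2 with hR₀
  have hbR : ‖b‖ < R₀ := by rw [hR₀]; linarith
  have hRρ : R₀ < ρ := by rw [hR₀]; linarith
  have hcont : ∀ R, 0 ≤ R → R ≤ 1 → Continuous fun θ => phiInv (circleMap 0 R θ) :=
    fun R h0 h1 => continuousOn_phiInv.comp_continuous (continuous_circleMap _ _)
      fun θ => mem_closedBall_zero_iff.2 (norm_circleMap_zero_le_one h0 h1 θ)
  have hlow : ∀ w : ℂ, ‖w‖ ≤ 1 → R₀ ≤ ‖w‖ →
      (R₀ - ‖b‖) / (Real.exp 2 * 2) ≤ ‖phiInv w - phiInv b‖ := by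
    intro w hw hw'
    rw [div_le_iff₀' (by positivity)]
    have h1 := norm_sub_le_phiInv hw hb1
    have h2 := norm_sub_norm_le w b
    linarith
  set δ := (R₀ - ‖b‖) / (Real.exp 2 * 2) with hδ
  have hδ0 : 0 < δ := div_pos (by linarith) (by positivity)
  have hev : ∀ᶠ R in 𝓝[<] ρ, R₀ < R ∧ R < ρ := by
    filter_upwards [Ioo_mem_nhdsLT hRρ] with R hR using hR
  have hne : ∀ᵐ θ : ℝ, θ ≠ 2 * Real.pi := by simp [ae_iff, measure_singleton]
  have hlim : Tendsto (fun R => ∫ θ in (0 : ℝ)..2 * Real.pi,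
      (fun w => phiInv w / ((1 - phiInv w) * (phiInv w - phiInv b))) (circleMap 0 R θ)) (𝓝[<] ρ)
      (𝓝 (∫ θ in (0 : ℝ)..2 * Real.pi,
      (fun w => phiInv w / ((1 - phiInv w) * (phiInv w - phiInv b))) (circleMap 0 ρ θ))) := by
    refine intervalIntegral.tendsto_integral_filter_of_dominated_convergence
      (fun θ => invBound θ * δ⁻¹) ?_ ?_ (intervalIntegrable_invBound.mul_const _) ?_
    · filter_upwards [hev] with R hR
      have hm := (hcont R (by linarith [norm_nonneg b]) (by linarith)).measurable
      exact (hm.div ((measurable_const.sub hm).mul (hm.sub_const _))).aestronglyMeasurable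
    · filter_upwards [hev] with R hR
      filter_upwards [hne] with θ hθ1 hθ
      rw [uIoc_of_le Real.two_pi_pos.le] at hθ
      have hθi : θ ∈ Ioo 0 (2 * Real.pi) := ⟨hθ.1, hθ.2.lt_of_ne hθ1⟩
      have hR0 : 0 ≤ R := by linarith [norm_nonneg b]
      have hR1 : R ≤ 1 := by linarith
      have hw := norm_circleMap_zero_le_one hR0 hR1 θ
      have h1 := inv_norm_one_sub_phiInv_le hR0 hR1 hθi
      have h2 := hlow _ hw (by rw [norm_circleMap_zero, abs_of_nonneg hR0]; exact hR.1.le)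
      rw [norm_div, norm_mul, div_eq_mul_inv, mul_inv]
      refine (mul_le_of_le_one_left (by positivity) (norm_phiInv_le hw)).trans ?_
      have h3 : ‖phiInv (circleMap 0 R θ) - phiInv b‖⁻¹ ≤ δ⁻¹ := inv_anti₀ hδ0 h2
      exact mul_le_mul h1 h3 (by positivity) ((by positivity : (0 : ℝ) ≤ _).trans h1)
    · filter_upwards [hne] with θ hθ1 hθ
      rw [uIoc_of_le Real.two_pi_pos.le] at hθ
      have hθi : θ ∈ Ioo 0 (2 * Real.pi) := ⟨hθ.1, hθ.2.lt_of_ne hθ1⟩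
      have hw := norm_circleMap_zero_le_one hρ0.le hρ1 θ
      have hw1 := circleMap_ne_one hρ0.le hρ1 hθi
      have hc : ContinuousAt phiInv (circleMap 0 ρ θ) := (hasDerivAt_phiInv hw hw1).continuousAt
      have hc2 : ContinuousAt (fun w => phiInv w / ((1 - phiInv w) * (phiInv w - phiInv b)))
          (circleMap 0 ρ θ) := by
        refine hc.div ((continuousAt_const.sub hc).mul (hc.sub continuousAt_const))
          (mul_ne_zero (sub_ne_zero.2 (phiInv_ne_one hw hw1).symm) ?_)
        have := hlow _ hw (by rw [norm_circleMap_zero, abs_of_pos hρ0]; exact hRρ.le)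
        exact norm_pos_iff.1 (hδ0.trans_le this)
      have hcR : Tendsto (fun R => circleMap 0 R θ) (𝓝[<] ρ) (𝓝 (circleMap 0 ρ θ)) := by
        refine Tendsto.mono_left (Continuous.tendsto ?_ ρ) nhdsWithin_le_nhds
        unfold circleMap
        fun_prop
      exact hc2.tendsto.comp hcR
  have hlim2 := hlim.const_smul (2 * Real.pi)⁻¹
  refine tendsto_nhds_unique hlim2 (tendsto_const_nhds.congr' ?_)
  filter_upwards [hev] with R hR
  exact (circleAverage_phiInv_div (by linarith) (by linarith)).symm

lemma windingNumber_levelPath (hr : 0 ≤ r) {a : ℂ} (ha : a ∈ levelInterior r) :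
    windingNumber (levelPath hr) a = 1 := by
  rw [← image_phiInv_ball hr] at ha
  obtain ⟨b, hb, rfl⟩ := ha
  have h := circleAverage_phiInv_div_exp hr (mem_ball_zero_iff.1 hb)
  set F : ℝ → ℂ := fun θ =>
    levelParam r θ / ((1 - levelParam r θ) * (levelParam r θ - phiInv b)) with hF
  have hne : ∀ᵐ t : ℝ, t ≠ 1 := by simp [ae_iff, measure_singleton]
  have h1 : ∫ t in (0 : ℝ)..1, deriv (levelPath hr).extend t /
      ((levelPath hr).extend t - phiInv b) =
      ∫ t in (0 : ℝ)..1, (2 * Real.pi * I) * F (2 * Real.pi * t) := by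
    refine intervalIntegral.integral_congr_ae ?_
    filter_upwards [hne] with t ht1 ht
    rw [uIoc_of_le zero_le_one] at ht
    rw [(hasDerivAt_levelPath hr ⟨ht.1, ht.2.lt_of_ne ht1⟩).deriv,
      levelPath_extend hr (Ioc_subset_Icc_self ht), hF, mul_div_assoc, div_div]
  rw [windingNumber, h1, intervalIntegral.integral_const_mul,
    inv_mul_cancel_left₀ Complex.two_pi_I_ne_zero,
    intervalIntegral.integral_comp_mul_left F Real.two_pi_pos.ne', mul_zero, mul_one]
  exact h

lemma isPositiveContour_levelPath (hr : 0 ≤ r) :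
    IsPositiveContour (levelPath hr) (levelCurve r) where
  absolutelyContinuous := absolutelyContinuous_levelPath hr
  simple := injOn_levelPath hr
  trace := range_levelPath hr
  counterclockwise _ ha := windingNumber_levelPath hr ha

end Szego

namespace Szego

open Complex Metric Set Filter Topology

/-! ### The Dirichlet problem -/

lemma circleAverage_poissonKernel {R : ℝ} {w : ℂ} (hw : w ∈ ball (0 : ℂ) R) (a : ℝ) :
    Real.circleAverage (fun ζ => poissonKernel 0 w ζ * a) 0 R = a := by
  have h : InnerProductSpace.HarmonicOnNhd (fun _ : ℂ => a) (closedBall 0 R) := by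
    intro x _
    exact InnerProductSpace.harmonicAt_const a
  exact h.circleAverage_poissonKernel_smul hw

lemma continuousOn_poissonKernel {R : ℝ} {w : ℂ} (hw : w ∈ ball (0 : ℂ) R) :
    ContinuousOn (poissonKernel 0 w) (sphere 0 |R|) := by
  rw [poissonKernel_eq_re_herglotzRieszKernel]
  exact continuous_re.comp_continuousOn (continuousOn_herglotzRieszKernel_sphere hw)

/-- Near `w₀` the function is within `ε/2` of its value there; on the far arc the kernel tends to
zero. The one-sided bound is enough, being applied to `F` and `-F`. -/
lemma eventually_circleAverage_poissonKernel_le {R : ℝ} (hR : 0 < R) {F : ℂ → ℝ}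
    (hF : ContinuousOn F (sphere 0 R)) {w₀ : ℂ} (hw₀ : w₀ ∈ sphere (0 : ℂ) R) {ε : ℝ}
    (hε : 0 < ε) :
    ∀ᶠ w in 𝓝[ball 0 R] w₀,
      Real.circleAverage (fun ζ => poissonKernel 0 w ζ * F ζ) 0 R ≤ F w₀ + ε := by
  obtain ⟨M, hM⟩ := (isCompact_sphere (0 : ℂ) R).exists_bound_of_continuousOn hF
  have hM0 : 0 ≤ M := (norm_nonneg _).trans (hM w₀ hw₀)
  obtain ⟨δ, hδ, hFδ⟩ := Metric.continuousOn_iff.1 hF w₀ hw₀ (ε / 2) (by linarith)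
  -- `D` majorizes the far contribution: points of the far arc are at distance at least `δ/2` from
  -- `w`, and `2M` bounds the oscillation of `F`.
  set D : ℂ → ℝ := fun w => (R ^ 2 - ‖w‖ ^ 2) / (δ / 2) ^ 2 * (2 * M) with hD
  have hDc : Continuous D := by
    simp only [hD]
    fun_prop
  have hD0 : D w₀ = 0 := by
    rw [mem_sphere_zero_iff_norm] at hw₀
    simp [hD, hw₀]
  have hDev : ∀ᶠ w in 𝓝[ball 0 R] w₀, D w < ε / 2 :=
    nhdsWithin_le_nhds (hDc.continuousAt.eventually_lt continuousAt_const (by rw [hD0]; linarith))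
  have hnear : ∀ᶠ w in 𝓝[ball 0 R] w₀, w ∈ ball w₀ (δ / 2) :=
    nhdsWithin_le_nhds (ball_mem_nhds _ (by linarith))
  filter_upwards [hDev, hnear, self_mem_nhdsWithin] with w hw1 hw2 hw3
  have hwR : ‖w‖ < R := mem_ball_zero_iff.1 hw3
  have hsq : 0 ≤ R ^ 2 - ‖w‖ ^ 2 := by nlinarith [norm_nonneg w]
  have hDw : 0 ≤ D w := by positivity
  have hKc := continuousOn_poissonKernel hw3
  have hKF : CircleIntegrable (fun ζ => poissonKernel 0 w ζ * F ζ) 0 R :=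
    (hKc.mul (by rwa [abs_of_pos hR])).circleIntegrable'
  have hKa : CircleIntegrable (fun ζ => poissonKernel 0 w ζ * (F w₀ + ε / 2)) 0 R :=
    (hKc.mul continuousOn_const).circleIntegrable'
  have hKD : CircleIntegrable (fun _ => D w) 0 R := continuousOn_const.circleIntegrable'
  calc Real.circleAverage (fun ζ => poissonKernel 0 w ζ * F ζ) 0 R
      ≤ Real.circleAverage (fun ζ => poissonKernel 0 w ζ * (F w₀ + ε / 2) + D w) 0 R := by
        refine Real.circleAverage_mono hKF (hKa.add hKD) fun ζ hζ => ?_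
        rw [abs_of_pos hR] at hζ
        have hζn := mem_sphere_zero_iff_norm.1 hζ
        have hK : poissonKernel 0 w ζ = (R ^ 2 - ‖w‖ ^ 2) / ‖ζ - w‖ ^ 2 := by
          rw [poissonKernel_def, sub_zero, sub_zero, hζn]
        have hK0 : 0 ≤ poissonKernel 0 w ζ := by rw [hK]; positivity
        rcases lt_or_ge (dist ζ w₀) δ with h | h
        · have h1 := (abs_lt.1 (hFδ ζ hζ h)).2
          have := mul_le_mul_of_nonneg_left (by linarith : F ζ ≤ F w₀ + ε / 2) hK0
          linarith
        · have h1 : δ / 2 ≤ ‖ζ - w‖ := by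
            have h2 := dist_triangle ζ w w₀
            rw [mem_ball] at hw2
            rw [← dist_eq_norm]
            linarith
          have hKle : poissonKernel 0 w ζ ≤ (R ^ 2 - ‖w‖ ^ 2) / (δ / 2) ^ 2 := by
            rw [hK]
            gcongr
          have h3 : F ζ - F w₀ ≤ 2 * M := by
            have h4 := (abs_le.1 (hM ζ hζ)).2
            have h5 := (abs_le.1 (hM w₀ hw₀)).1
            linarith
          have h6 : poissonKernel 0 w ζ * (F ζ - F w₀) ≤ D w :=
            (mul_le_mul_of_nonneg_left h3 hK0).trans
              (mul_le_mul_of_nonneg_right hKle (by linarith))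
          have h7 : 0 ≤ poissonKernel 0 w ζ * (ε / 2) := mul_nonneg hK0 (by linarith)
          linarith
    _ = F w₀ + ε / 2 + D w := by
        rw [Real.circleAverage_fun_add hKa hKD, circleAverage_poissonKernel hw3,
          Real.circleAverage_const]
    _ ≤ F w₀ + ε := by linarith

lemma tendsto_circleAverage_poissonKernel {R : ℝ} (hR : 0 < R) {F : ℂ → ℝ}
    (hF : ContinuousOn F (sphere 0 R)) {w₀ : ℂ} (hw₀ : w₀ ∈ sphere (0 : ℂ) R) :
    Tendsto (fun w => Real.circleAverage (fun ζ => poissonKernel 0 w ζ * F ζ) 0 R)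
      (𝓝[ball 0 R] w₀) (𝓝 (F w₀)) := by
  rw [Metric.tendsto_nhds]
  intro ε hε
  filter_upwards [eventually_circleAverage_poissonKernel_le hR hF hw₀ (half_pos hε),
    eventually_circleAverage_poissonKernel_le hR hF.neg hw₀ (half_pos hε)] with w h1 h2
  have h3 : Real.circleAverage (fun ζ => poissonKernel 0 w ζ * -F ζ) 0 R =
      -Real.circleAverage (fun ζ => poissonKernel 0 w ζ * F ζ) 0 R := by
    have := Real.circleAverage_fun_smul (a := (-1 : ℝ)) (c := 0) (R := R)
      (f := fun ζ => poissonKernel 0 w ζ * F ζ)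
    simpa using this
  simp only [Pi.neg_apply, h3] at h2
  rw [Real.dist_eq, abs_lt]
  constructor <;> linarith

/-- Solution of the Dirichlet problem in a disk, as the real part of an analytic function. -/
lemma exists_analytic_re_extension {R : ℝ} (hR : 0 < R) {F : ℂ → ℝ}
    (hF : ContinuousOn F (sphere 0 R)) :
    ∃ H : ℂ → ℂ, AnalyticOnNhd ℂ H (ball 0 R) ∧ (H 0).re = Real.circleAverage F 0 R ∧
      ContinuousOn (fun w => if ‖w‖ < R then (H w).re else F w) (closedBall 0 R) := by
  have hFi : CircleIntegrable F 0 R := hF.circleIntegrable hR.le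
  have hFi' : CircleIntegrable (fun ζ => (F ζ : ℂ)) 0 R :=
    (continuous_ofReal.comp_continuousOn hF).circleIntegrable hR.le
  set H : ℂ → ℂ := fun w =>
    Real.circleAverage (fun ζ => herglotzRieszKernel 0 w ζ • (F ζ : ℂ)) 0 R with hH
  have hHa : AnalyticOnNhd ℂ H (ball 0 R) :=
    analyticOnNhd_circleAverage_herglotzRieszKernel_smul hFi'
  have hHre : ∀ w ∈ ball (0 : ℂ) R,
      (H w).re = Real.circleAverage (fun ζ => poissonKernel 0 w ζ * F ζ) 0 R := by
    intro w hw
    rw [hH, re_circleAverage_herglotzRieszKernel_smul hFi hw,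
      ← poissonKernel_eq_re_herglotzRieszKernel]
    rfl
  refine ⟨H, hHa, ?_, ?_⟩
  · rw [hHre 0 (mem_ball_self hR)]
    refine Real.circleAverage_congr_sphere fun ζ hζ => ?_
    rw [abs_of_pos hR, mem_sphere_zero_iff_norm] at hζ
    simp only [poissonKernel_def, sub_zero, norm_zero, hζ]
    field_simp
    ring
  · intro w₀ hw₀
    rw [mem_closedBall_zero_iff] at hw₀
    rcases hw₀.lt_or_eq with h | h
    · refine ContinuousAt.continuousWithinAt ?_
      have hc : ContinuousAt (fun w => (H w).re) w₀ :=
        continuous_re.continuousAt.comp (hHa w₀ (mem_ball_zero_iff.2 h)).continuousAt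
      refine hc.congr ?_
      filter_upwards [isOpen_ball.mem_nhds (mem_ball_zero_iff.2 h)] with w hw
      rw [if_pos (mem_ball_zero_iff.1 hw)]
    · have hs : w₀ ∈ sphere (0 : ℂ) R := mem_sphere_zero_iff_norm.2 h
      rw [← ball_union_sphere, ContinuousWithinAt, nhdsWithin_union,
        if_neg (by rw [h]; exact lt_irrefl R)]
      refine Tendsto.sup ?_ ?_
      · refine (tendsto_circleAverage_poissonKernel hR hF hs).congr' ?_
        filter_upwards [self_mem_nhdsWithin] with w hw
        rw [if_pos (mem_ball_zero_iff.1 hw), hHre w hw]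
      · refine (hF w₀ hs).congr' ?_
        filter_upwards [self_mem_nhdsWithin] with w hw
        rw [if_neg (by rw [mem_sphere_zero_iff_norm.1 hw]; exact lt_irrefl R)]

variable {r : ℝ}

lemma integral_levelMeasure (hr : 0 ≤ r) {f : ℂ → ℝ}
    (hf : AEStronglyMeasurable f (levelMeasure r)) :
    ∫ z, f z ∂levelMeasure r = Real.circleAverage (fun w => f (phiInv w)) 0 (Real.exp (-r)) := by
  have hf' : AEStronglyMeasurable f
      ((volume.restrict (Ioc 0 (2 * Real.pi))).map (levelParam r)) := by
    refine hf.mono_ac ?_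
    rw [levelMeasure]
    exact Measure.absolutelyContinuous_smul (ENNReal.inv_ne_zero.2 ENNReal.ofReal_ne_top)
  rw [levelMeasure, integral_smul_measure,
    integral_map (continuous_levelParam hr).measurable.aemeasurable hf', ENNReal.toReal_inv,
    ENNReal.toReal_ofReal Real.two_pi_pos.le, Real.circleAverage_def,
    intervalIntegral.integral_of_le Real.two_pi_pos.le]
  rfl

/-- The disk solution composed with `phi` is the real part of an analytic function, and its value at
`0` is the circle mean because `phi 0 = 0`. -/
lemma isHarmonicMeasure_levelMeasure (hr : 0 ≤ r) :
    IsHarmonicMeasure (levelInterior r) 0 (levelMeasure r) where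
  isOpen := isOpen_levelInterior hr
  isConnected := isConnected_levelInterior hr
  isBounded := isBounded_levelInterior hr
  mem := zero_mem_levelInterior hr
  isProbabilityMeasure := isProbabilityMeasure_levelMeasure hr
  carrier := by
    rw [frontier_levelInterior hr]
    exact levelMeasure_compl hr
  dirichlet := by
    intro f hf
    rw [frontier_levelInterior hr] at hf ⊢
    have hρ := Real.exp_pos (-r)
    have hsub : closedBall (0 : ℂ) (Real.exp (-r)) ⊆ closedBall 0 1 :=
      closedBall_subset_closedBall (exp_neg_le_one hr)
    have hF : ContinuousOn (fun w => f (phiInv w)) (sphere 0 (Real.exp (-r))) := by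
      refine hf.comp (continuousOn_phiInv.mono (sphere_subset_closedBall.trans hsub))
        fun w hw => ?_
      have hw' := mem_sphere_zero_iff_norm.1 hw
      have hw1 : ‖w‖ ≤ 1 := hw'.le.trans (exp_neg_le_one hr)
      exact ⟨by rw [phi_phiInv hw1, hw'], norm_phiInv_le hw1⟩
    obtain ⟨H, hHa, hH0, hHc⟩ := exists_analytic_re_extension hρ hF
    refine ⟨fun z => if ‖phi z‖ < Real.exp (-r) then (H (phi z)).re else f (phiInv (phi z)),
      ?_, ?_, ?_, ?_⟩
    · rw [closure_levelInterior hr]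
      exact hHc.comp continuous_phi.continuousOn fun z hz => mem_closedBall_zero_iff.2 hz.2
    · intro z hz
      have hmaps := (bijOn_phi_levelInterior hr).mapsTo
      have ha : AnalyticAt ℂ (fun z => H (phi z)) z :=
        (hHa _ (hmaps hz)).comp (differentiable_phi.analyticAt z)
      refine (InnerProductSpace.harmonicAt_congr_nhds ?_).2 ha.harmonicAt_re
      filter_upwards [(isOpen_levelInterior hr).mem_nhds hz] with y hy
      rw [if_pos (mem_ball_zero_iff.1 (hmaps hy))]
    · intro z hz
      simp only
      rw [if_neg (by rw [hz.1]; exact lt_irrefl _), phiInv_phi hz.2]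
    · have hm : AEStronglyMeasurable f (levelMeasure r) := by
        have := hf.aestronglyMeasurable (μ := levelMeasure r)
          (isCompact_levelCurve r).measurableSet
        rwa [Measure.restrict_eq_self_of_ae_mem] at this
        rw [ae_iff]
        exact levelMeasure_compl hr
      rw [integral_levelMeasure hr hm, ← hH0]
      simp only [phi_zero, norm_zero]
      rw [if_pos hρ]

end Szego

namespace Szego

open Complex Metric Set Filter Topology

variable {r : ℝ}

/-! ### Logarithmic potentials -/

lemma logKernelPos_of_ne {z t : ℂ} (h : t ≠ z) :
    logKernelPos z t = ENNReal.ofReal (-Real.log ‖z - t‖) := by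
  have hpos : 0 < dist z t := dist_pos.2 h.symm
  rw [logKernelPos, ENNReal.log_inv, edist_dist, ENNReal.log_ofReal_of_pos hpos, ← EReal.coe_neg,
    EReal.real_coe_toENNReal, dist_eq_norm]

lemma logKernelNeg_of_ne {z t : ℂ} (h : t ≠ z) :
    logKernelNeg z t = ENNReal.ofReal (Real.log ‖z - t‖) := by
  have hpos : 0 < dist z t := dist_pos.2 h.symm
  rw [logKernelNeg, edist_dist, ENNReal.log_ofReal_of_pos hpos, EReal.real_coe_toENNReal,
    dist_eq_norm]

/-- The point `t = z` must be null: there the kernel is infinite while `Real.log 0 = 0`.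
Integrability makes both parts finite, so the extended subtraction is an ordinary one. -/
lemma logPotential_eq {μ : Measure ℂ} {z : ℂ} (hz : ∀ᵐ t ∂μ, t ≠ z)
    (hi : Integrable (fun t => Real.log ‖z - t‖) μ) :
    logPotential μ z = ((-∫ t, Real.log ‖z - t‖ ∂μ : ℝ) : EReal) := by
  have h1 : ∫⁻ t, logKernelPos z t ∂μ = ∫⁻ t, ENNReal.ofReal (-Real.log ‖z - t‖) ∂μ :=
    lintegral_congr_ae (hz.mono fun t ht => logKernelPos_of_ne ht)
  have h2 : ∫⁻ t, logKernelNeg z t ∂μ = ∫⁻ t, ENNReal.ofReal (Real.log ‖z - t‖) ∂μ :=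
    lintegral_congr_ae (hz.mono fun t ht => logKernelNeg_of_ne ht)
  have hfin1 : ∫⁻ t, ENNReal.ofReal (-Real.log ‖z - t‖) ∂μ ≠ ⊤ := hi.neg.lintegral_lt_top.ne
  have hfin2 : ∫⁻ t, ENNReal.ofReal (Real.log ‖z - t‖) ∂μ ≠ ⊤ := hi.lintegral_lt_top.ne
  rw [logPotential, h1, h2, integral_eq_lintegral_pos_part_sub_lintegral_neg_part hi, neg_sub,
    EReal.coe_sub, EReal.coe_ennreal_toReal hfin1,
    EReal.coe_ennreal_toReal hfin2]

lemma logCapacity_empty : logCapacity ∅ = 0 := by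
  rw [logCapacity]
  refine le_antisymm (iSup₂_le fun μ hμ => ?_) bot_le
  obtain ⟨hp, K, hK, -, h0⟩ := hμ
  rw [subset_empty_iff.1 hK, compl_empty] at h0
  have := hp.measure_univ
  rw [h0] at this
  exact absurd this zero_ne_one

/-- From a point off `G_r`, the distance to `φ⁻¹(w)` is bounded below by a multiple of the distance
of `w` to a fixed boundary point. -/
lemma exists_mul_norm_sub_le (hr : 0 ≤ r) {z : ℂ} (hz : z ∉ levelInterior r) :
    ∃ c > 0, ∃ w₀ : ℂ, ‖w₀‖ = Real.exp (-r) ∧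
      ∀ w : ℂ, ‖w‖ ≤ Real.exp (-r) → c * ‖w₀ - w‖ ≤ ‖z - phiInv w‖ := by
  by_cases hzc : z ∈ levelCurve r
  · refine ⟨(Real.exp 2 * 2)⁻¹, by positivity, phi z, hzc.1, fun w hw => ?_⟩
    rw [inv_mul_le_iff₀ (by positivity)]
    have hw1 := hw.trans (exp_neg_le_one hr)
    have := norm_sub_le_phiInv (hzc.1.le.trans (exp_neg_le_one hr)) hw1
    rwa [phiInv_phi hzc.2] at this
  · have hcl : z ∉ closure (levelInterior r) := by
      rw [closure_eq_self_union_frontier, frontier_levelInterior hr]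
      exact fun h => h.elim hz hzc
    have hd : 0 < infDist z (closure (levelInterior r)) :=
      (isClosed_closure.notMem_iff_infDist_pos ⟨0, subset_closure (zero_mem_levelInterior hr)⟩).1
        hcl
    -- Any boundary point serves as `w₀`, since its distance to `w` is at most `2`.
    refine ⟨infDist z (closure (levelInterior r)) / 2, by positivity, (Real.exp (-r) : ℝ), ?_,
      fun w hw => ?_⟩
    · rw [norm_real, Real.norm_of_nonneg (Real.exp_pos _).le]
    · have hw1 := hw.trans (exp_neg_le_one hr)
      have h1 : ‖((Real.exp (-r) : ℝ) : ℂ) - w‖ ≤ 2 := by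
        refine (norm_sub_le _ _).trans ?_
        rw [norm_real, Real.norm_of_nonneg (Real.exp_pos _).le]
        linarith [exp_neg_le_one hr]
      have hmem : phiInv w ∈ closure (levelInterior r) := by
        rw [closure_levelInterior hr]
        exact ⟨norm_phiInv_le hw1, by rwa [phi_phiInv hw1]⟩
      have h2 := infDist_le_dist_of_mem hmem (x := z)
      rw [dist_eq_norm] at h2
      refine le_trans ?_ h2
      rw [div_mul_eq_mul_div, div_le_iff₀ two_pos]
      exact mul_le_mul_of_nonneg_left h1 hd.le

/-- `z - W(w)` has no zero in the disk because `z` is off `G_r`, and `W(0) = 0`. -/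
lemma circleAverage_log_norm_sub_phiInv_of_lt (hr : 0 ≤ r) {z : ℂ} (hz : z ∉ levelInterior r)
    {R : ℝ} (hR : 0 < R) (hRρ : R < Real.exp (-r)) :
    Real.circleAverage (fun w => Real.log ‖z - phiInv w‖) 0 R = Real.log ‖z‖ := by
  have hsub : ball (0 : ℂ) (Real.exp (-r)) ⊆ ball 0 1 := ball_subset_ball (exp_neg_le_one hr)
  have hWd : DifferentiableOn ℂ (fun w => z - phiInv w) (ball 0 1) := fun w hw => by
    refine ((differentiableAt_const z).sub (hasDerivAt_phiInv (mem_ball_zero_iff.1 hw).le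
      fun h => ?_).differentiableAt).differentiableWithinAt
    simp [h] at hw
  have hcb : closedBall (0 : ℂ) |R| ⊆ ball 0 (Real.exp (-r)) := by
    rw [abs_of_pos hR]; exact closedBall_subset_ball hRρ
  have h := AnalyticOnNhd.circleAverage_log_norm_of_ne_zero (c := 0) (R := R)
    (g := fun w => z - phiInv w)
    ((hWd.analyticOnNhd isOpen_ball).mono (hcb.trans hsub)) (fun w hw => ?_)
  · simpa using h
  · refine sub_ne_zero.2 fun h => hz ?_
    rw [h, ← image_phiInv_ball hr]
    exact mem_image_of_mem _ (hcb hw)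

/-- When `z` lies on the curve the boundary integrand has a logarithmic singularity. The lower bound
`exists_mul_norm_sub_le` dominates it uniformly in the radius by `log |ρ e^{iθ} - w₀|`, so the mean
passes to the limit. -/
lemma circleAverage_log_norm_sub_phiInv (hr : 0 ≤ r) {z : ℂ} (hz : z ∉ levelInterior r) :
    CircleIntegrable (fun w => Real.log ‖z - phiInv w‖) 0 (Real.exp (-r)) ∧
    Real.circleAverage (fun w => Real.log ‖z - phiInv w‖) 0 (Real.exp (-r)) = Real.log ‖z‖ := by
  obtain ⟨c, hc, w₀, hw₀, hlow⟩ := exists_mul_norm_sub_le hr hz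
  set ρ := Real.exp (-r) with hρ
  have hρ1 : ρ ≤ 1 := exp_neg_le_one hr
  have hρ0 : 0 < ρ := Real.exp_pos _
  set B : ℝ → ℝ := fun θ =>
    |Real.log (‖z‖ + 1)| + |Real.log (c / 2)| + |Real.log ‖circleMap 0 ρ θ - w₀‖| with hB
  have hBi : IntervalIntegrable B volume 0 (2 * Real.pi) :=
    (intervalIntegrable_const.add intervalIntegrable_const).add
      (circleIntegrable_log_norm_sub_const (a := w₀) (c := 0) ρ).abs
  have hae : ∀ᵐ θ : ℝ, circleMap 0 ρ θ ≠ w₀ := by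
    have := ((countable_singleton w₀).preimage_circleMap 0 hρ0.ne').ae_notMem volume
    exact this
  have hbound : ∀ R, 0 ≤ R → R ≤ ρ → ∀ θ, circleMap 0 ρ θ ≠ w₀ →
      ‖Real.log ‖z - phiInv (circleMap 0 R θ)‖‖ ≤ B θ := by
    intro R hR hRρ θ hθ
    have hp : 0 < ‖circleMap 0 ρ θ - w₀‖ := norm_pos_iff.2 (sub_ne_zero.2 hθ)
    have hnw : ‖circleMap 0 R θ‖ ≤ ρ := by rwa [norm_circleMap_zero, abs_of_nonneg hR]
    have h1 := hlow _ hnw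
    have h2 := norm_circleMap_sub_le_two_mul (θ := θ) hR hRρ hw₀
    rw [norm_sub_rev w₀ (circleMap 0 ρ θ)] at h2
    have h3 : c / 2 * ‖circleMap 0 ρ θ - w₀‖ ≤ ‖z - phiInv (circleMap 0 R θ)‖ := by
      refine le_trans ?_ h1
      rw [div_mul_eq_mul_div, div_le_iff₀ two_pos, mul_assoc, mul_comm _ (2 : ℝ)]
      exact mul_le_mul_of_nonneg_left h2 hc.le
    have h4 : ‖z - phiInv (circleMap 0 R θ)‖ ≤ ‖z‖ + 1 :=
      (norm_sub_le _ _).trans (by linarith [norm_phiInv_le (hnw.trans hρ1)])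
    have hlog1 := Real.log_le_log (by positivity) h3
    have hlog2 := Real.log_le_log ((by positivity : 0 < c / 2 * ‖circleMap 0 ρ θ - w₀‖).trans_le h3)
      h4
    rw [Real.log_mul (by positivity) hp.ne'] at hlog1
    rw [Real.norm_eq_abs, abs_le, hB]
    have a1 := neg_abs_le (Real.log (c / 2))
    have a2 := neg_abs_le (Real.log ‖circleMap 0 ρ θ - w₀‖)
    have a3 := le_abs_self (Real.log (‖z‖ + 1))
    have a4 := abs_nonneg (Real.log (c / 2))
    have a5 := abs_nonneg (Real.log ‖circleMap 0 ρ θ - w₀‖)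
    have a6 := abs_nonneg (Real.log (‖z‖ + 1))
    constructor <;> dsimp only <;> linarith
  have hmeas : ∀ R, 0 ≤ R → R ≤ ρ →
      Measurable fun θ => Real.log ‖z - phiInv (circleMap 0 R θ)‖ := fun R hR hRρ =>
    Real.measurable_log.comp (continuous_const.sub (continuousOn_phiInv.comp_continuous
      (continuous_circleMap 0 R) fun θ => mem_closedBall_zero_iff.2
        (norm_circleMap_zero_le_one hR (hRρ.trans hρ1) θ))).norm.measurable
  constructor
  · refine hBi.mono_fun (hmeas ρ hρ0.le le_rfl).aestronglyMeasurable ?_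
    refine ae_restrict_of_ae ?_
    filter_upwards [hae] with θ hθ
    exact (hbound ρ hρ0.le le_rfl θ hθ).trans (le_abs_self _)
  · have hev : ∀ᶠ R in 𝓝[<] ρ, 0 < R ∧ R < ρ := by
      filter_upwards [Ioo_mem_nhdsLT hρ0] with R hR using hR
    have hlim : Tendsto (fun R => ∫ θ in (0 : ℝ)..2 * Real.pi,
        Real.log ‖z - phiInv (circleMap 0 R θ)‖) (𝓝[<] ρ)
        (𝓝 (∫ θ in (0 : ℝ)..2 * Real.pi, Real.log ‖z - phiInv (circleMap 0 ρ θ)‖)) := by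
      refine intervalIntegral.tendsto_integral_filter_of_dominated_convergence B ?_ ?_ hBi ?_
      · filter_upwards [hev] with R hR
        exact (hmeas R hR.1.le hR.2.le).aestronglyMeasurable
      · filter_upwards [hev] with R hR
        filter_upwards [hae] with θ hθ _
        exact hbound R hR.1.le hR.2.le θ hθ
      · filter_upwards [hae] with θ hθ _
        have hnw : ‖circleMap 0 ρ θ‖ = ρ := by rw [norm_circleMap_zero, abs_of_pos hρ0]
        have hcW : Tendsto (fun R => phiInv (circleMap 0 R θ)) (𝓝[<] ρ)
            (𝓝 (phiInv (circleMap 0 ρ θ))) := by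
          refine (continuousOn_phiInv (circleMap 0 ρ θ)
            (mem_closedBall_zero_iff.2 (hnw.le.trans hρ1))).tendsto.comp
            (tendsto_nhdsWithin_iff.2 ⟨?_, ?_⟩)
          · refine Tendsto.mono_left (Continuous.tendsto ?_ ρ) nhdsWithin_le_nhds
            unfold circleMap
            fun_prop
          · filter_upwards [hev] with R hR
            exact mem_closedBall_zero_iff.2
              (norm_circleMap_zero_le_one hR.1.le (hR.2.le.trans hρ1) θ)
        refine ((tendsto_const_nhds.sub hcW).norm).log ?_
        have h1 := hlow _ hnw.le
        have hp : 0 < ‖w₀ - circleMap 0 ρ θ‖ := norm_pos_iff.2 (sub_ne_zero.2 hθ.symm)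
        exact ((mul_pos hc hp).trans_le h1).ne'
    refine tendsto_nhds_unique (hlim.const_smul (2 * Real.pi)⁻¹) (tendsto_const_nhds.congr' ?_)
    filter_upwards [hev] with R hR
    exact (circleAverage_log_norm_sub_phiInv_of_lt hr hz hR.1 hR.2).symm

lemma ae_levelMeasure_ne (hr : 0 ≤ r) (z : ℂ) : ∀ᵐ t ∂levelMeasure r, t ≠ z := by
  have hs : {t : ℂ | ¬t ≠ z} = {z} := by ext; simp
  rw [ae_iff, hs, levelMeasure_apply hr (measurableSet_singleton z)]
  have hsub : levelParam r ⁻¹' {z} ⊆ circleMap 0 (Real.exp (-r)) ⁻¹' {phi z} := by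
    intro θ hθ
    have h : levelParam r θ = z := hθ
    rw [mem_preimage, mem_singleton_iff, ← h, phi_levelParam hr]
  have hc := ((countable_singleton (phi z)).preimage_circleMap 0 (Real.exp_pos (-r)).ne').mono
    ((inter_subset_left (t := Ioc 0 (2 * Real.pi))).trans hsub)
  rw [hc.measure_zero volume, mul_zero]

lemma logPotential_levelMeasure (hr : 0 ≤ r) {z : ℂ} (hz : z ∉ levelInterior r) :
    logPotential (levelMeasure r) z = ((-Real.log ‖z‖ : ℝ) : EReal) := by
  obtain ⟨hi, hv⟩ := circleAverage_log_norm_sub_phiInv hr hz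
  have hm : Measurable fun t : ℂ => Real.log ‖z - t‖ :=
    Real.measurable_log.comp (measurable_const.sub measurable_id).norm
  have hfint : Integrable (fun t => Real.log ‖z - t‖) (levelMeasure r) := by
    have hpi : ENNReal.ofReal (2 * Real.pi) ≠ 0 := by simpa using Real.pi_pos
    refine Integrable.smul_measure ?_ (ENNReal.inv_ne_top.2 hpi)
    rw [integrable_map_measure hm.aestronglyMeasurable
      (continuous_levelParam hr).measurable.aemeasurable]
    exact hi.1
  rw [logPotential_eq (ae_levelMeasure_ne hr z) hfint,
    integral_levelMeasure hr hm.aestronglyMeasurable, hv]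

lemma logPotential_dirac_zero {z : ℂ} (hz : z ≠ 0) :
    logPotential (Measure.dirac 0) z = ((-Real.log ‖z‖ : ℝ) : EReal) := by
  rw [logPotential_eq]
  · simp
  · rw [ae_dirac_eq]
    exact hz.symm
  · exact integrable_dirac (by finiteness)

lemma isBalayage_levelMeasure (hr : 0 ≤ r) :
    IsBalayage (levelInterior r) (Measure.dirac 0) (levelMeasure r) where
  isOpen := isOpen_levelInterior hr
  isCompact_frontier := by
    rw [frontier_levelInterior hr]
    exact isCompact_levelCurve r
  finite := inferInstance
  compactSupport := ⟨{0}, singleton_subset_iff.2 (zero_mem_levelInterior hr), isCompact_singleton,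
    by simp⟩
  carrier := by
    rw [frontier_levelInterior hr]
    exact levelMeasure_compl hr
  mass_eq := by
    rw [(isProbabilityMeasure_levelMeasure hr).measure_univ, measure_univ]
  potential_eq := by
    -- The potentials agree at every point off `G_r`, so no exceptional set is needed.
    refine ⟨0, fun _ => rfl, ∅, MeasurableSet.empty, logCapacity_empty, fun z hz => ?_⟩
    have hz' : z ∉ levelInterior r := hz.1
    have hz0 : z ≠ 0 := fun h => hz' (h ▸ zero_mem_levelInterior hr)
    beta_reduce
    rw [logPotential_levelMeasure hr hz', logPotential_dirac_zero hz0, ← EReal.coe_sub, sub_self]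

end Szego

theorem lemma2p1 (r : ℝ) (hr : 0 ≤ r) :
    -- `Γ_r` is a closed contour around `0`, the common boundary curve of its interior `G_r`
    (∃ (x : ℂ) (γ : Path x x), IsPositiveContour γ (levelCurve r)) ∧
    0 ∈ levelInterior r ∧
    frontier (levelInterior r) = levelCurve r ∧
    -- `φ` maps `G_r` conformally onto the disk of radius `e^{-r}`, and `Γ_r` one-to-one onto its
    -- boundary circle
    DifferentiableOn ℂ phi (levelInterior r) ∧
    Set.BijOn phi (levelInterior r) (Metric.ball 0 (Real.exp (-r))) ∧
    Set.BijOn phi (levelCurve r) (Metric.sphere 0 (Real.exp (-r))) ∧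
    ∃ μ : Measure ℂ,
      -- the complex measure `(1 / 2πi) ((1 - z) / z) dz` on `Γ_r` is the positive measure `μ`
      (∀ (x : ℂ) (γ : Path x x), IsPositiveContour γ (levelCurve r) →
        ∀ A : Set ℂ, MeasurableSet A → lineMeasure szegoDensity γ A = ((μ.real A : ℝ) : ℂ)) ∧
      -- `μ` is a unit measure on `Γ_r`
      IsProbabilityMeasure μ ∧
      μ (levelCurve r)ᶜ = 0 ∧
      -- `μ` is the balayage of `δ_0` from `G_r` onto `Γ_r`
      IsBalayage (levelInterior r) (Measure.dirac 0) μ ∧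
      -- `μ` is the harmonic measure of `G_r` at `0`
      IsHarmonicMeasure (levelInterior r) 0 μ ∧
      -- `μ` is the preimage of normalized arc length under `φ`
      (∀ A ⊆ levelCurve r, MeasurableSet A →
        μ A = circleArcLength (Real.exp (-r)) (phi '' A)) := by
  exact ⟨⟨_, _, isPositiveContour_levelPath hr⟩, zero_mem_levelInterior hr,
    frontier_levelInterior hr, differentiable_phi.differentiableOn, bijOn_phi_levelInterior hr,
    bijOn_phi_levelCurve hr, levelMeasure r,
    fun _ _ hγ _ hA => lineMeasure_szegoDensity hr hγ hA, isProbabilityMeasure_levelMeasure hr,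
    levelMeasure_compl hr, isBalayage_levelMeasure hr, isHarmonicMeasure_levelMeasure hr,
    fun _ hA hAm => levelMeasure_eq_circleArcLength hr hA hAm⟩
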